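/- Manifolds are smooth, finite-dimensional, Hausdorff and second countable, without boundary; $\mathbb R^\times$ is the multiplicative group of nonzero reals. An $\mathbb R^\times$-principal bundle $\pi:P\to M$ is given by a smooth action $h$ of $\mathbb R^\times$ on $P$ preserving the fibres of the smooth map $\pi$, such that every point of $M$ has an open neighbourhood $U$ with an equivariant diffeomorphism $\pi^{-1}(U)\simeq U\times\mathbb R^\times$ over $U$. It is a symplectic $\mathbb R^\times$-principal bundle if $P$ carries a symplectic form $\omega$ that is 1-homogeneous, i.e. $h_s^*\omega=s\,\omega$ for all $s\in\mathbb R^\times$. The lifted action $\mathrm d_{\mathsf T}h$ on $\mathsf TP$ is $(\mathrm d_{\mathsf T}h)_s=\mathsf Th_s$; the (total space of the) Atiyah algebroid is the orbit space $\mathsf AP=\mathsf TP/\mathbb R^\times$ with the quotient topology; the tangent lift of a form $\omega$ on $P$ is the form $\mathrm d_{\mathsf T}\omega=\mathrm d(i_{\mathsf T}\omega)+i_{\mathsf T}(\mathrm d\omega)$ on $\mathsf TP$, where $(i_{\mathsf T}\alpha)_v(A_1,\dots,A_k)=\alpha(v,\mathsf T\tau_P A_1,\dots,\mathsf T\tau_P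 A_k)$ and $\tau_P:\mathsf TP\to P$ is the projection. A contact structure on a manifold of odd dimension is a field of tangent hyperplanes that is locally the kernel of a smooth contact form, that is, of a nowhere vanishing 1-form $\eta$ with $\mathrm d\eta$ non-degenerate on $\ker\eta$. The contact structure corresponding to a symplectic $\mathbb R^\times$-principal bundle $(\pi:P\to M,\omega)$ is the field of hyperplanes $C\subset\mathsf TM$ with $(\mathsf T\pi)^{-1}(C)=\ker(i_\nabla\omega)$, where $\nabla_p=\frac{\mathrm d}{\mathrm ds}\big|_{s=1}h_s(p)$ is the Euler vector field. **Theorem.** Let $\pi:P\to M$ be a symplectic $\mathbb R^\times$-principal bundle with action $h$ and 1-homogeneous symplectic form $\omega$. Then $\mathsf AP$ has a smooth manifold structure (Hausdorff, second countable, of dimension $2\dim M+1$), unique among the smooth structures on this topological space, of that dimension, for which the canonical projection $\mathsf TP\to\mathsf AP$ is an $\mathbb R^\times$-principal bundle with respect to $\mathrm d_{\mathsf T}h$; and with this structure $(\mathsf TP\to\mathsf AP,\ \mathrm d_{\mathsf T}\omega)$ is a symplectic $\mathbb R^\times$-principal bundle. Consequently $\mathsf AP$ carries a canonical contact structure, namely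 the unique contact structure corresponding to $(\mathsf TP\to\mathsf AP,\mathrm d_{\mathsf T}\omega)$ (the principal lift of the contact structure on $M$). -/

import Mathlib

open Set Function
open scoped Manifold ContDiff Topology

noncomputable section

namespace ContactLift

/-! ### Differential forms on manifolds -/

section Forms

variable {E : Type*} [NormedAddCommGroup E] [NormedSpace ℝ E]
  {H : Type*} [TopologicalSpace H] (I : ModelWithCorners ℝ E H)
  (X : Type*) [TopologicalSpace X] [ChartedSpace H X]

/-- A (not necessarily smooth) differential `k`-form on the manifold `X`. -/
abbrev DForm (k : ℕ) : Type _ := ∀ x : X, TangentSpace I x [⋀^Fin k]→L[ℝ] ℝ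

variable {X}
variable {E' : Type*} [NormedAddCommGroup E'] [NormedSpace ℝ E']
  {H' : Type*} [TopologicalSpace H'] (I' : ModelWithCorners ℝ E' H')
  {X' : Type*} [TopologicalSpace X'] [ChartedSpace H' X']

/-- The pull-back `f^* η`, `(f^* η)_x (v₁, …, vₖ) = η_{f x} (T f v₁, …, T f vₖ)`. -/
def DForm.pullback {k : ℕ} (f : X → X') (η : DForm I' X' k) : DForm I X k :=
  fun x => (η (f x)).compContinuousLinearMap (mfderiv I I' f x)

/-- The form `η` written in the preferred chart at `x₀`, as a form on (an open subset of) the model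
vector space: the pull-back of `η` by the inverse of the chart. -/
def DForm.inChart {k : ℕ} (η : DForm I X k) (x₀ : X) : E → E [⋀^Fin k]→L[ℝ] ℝ :=
  DForm.pullback 𝓘(ℝ, E) I (extChartAt I x₀).symm η

/-- Smoothness of a form on an open subset `U`: it is smooth in all charts. -/
def DForm.SmoothOn {k : ℕ} (η : DForm I X k) (U : Set X) : Prop :=
  ∀ x₀ : X, ContDiffOn ℝ ∞ (η.inChart I x₀)
    ((extChartAt I x₀).target ∩ (extChartAt I x₀).symm ⁻¹' U)

/-- The exterior derivative of a form: at `x` it is the pull-back by the chart at `x` of the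
exterior derivative of the form written in that chart. -/
def DForm.d {k : ℕ} (η : DForm I X k) : DForm I X (k + 1) :=
  fun x => (extDeriv (η.inChart I x) (extChartAt I x x)).compContinuousLinearMap
    (mfderiv I 𝓘(ℝ, E) (extChartAt I x) x : TangentSpace I x →L[ℝ] E)

/-- A symplectic form: a smooth, closed and non-degenerate `2`-form. -/
structure IsSymplectic (Ω : DForm I X 2) : Prop where
  smooth : Ω.SmoothOn I univ
  closed : Ω.d I = 0
  nondegenerate : ∀ (x : X) (v : TangentSpace I x),
    (∀ w : TangentSpace I x, Ω x ![v, w] = 0) → v = 0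

/-! ### Tangent lift of differential forms -/

variable [IsManifold I ∞ X]

/-- The tautological contraction `i_T η` of a `(k+1)`-form on `X`, a `k`-form on `T X`:
`(i_T η)_v (A₁, …, Aₖ) = η (v, T τ A₁, …, T τ Aₖ)`, with `τ : T X → X` the projection. -/
def DForm.iT {k : ℕ} (η : DForm I X (k + 1)) : DForm I.tangent (TangentBundle I X) k :=
  fun v =>
    (ContinuousAlternatingMap.curryLeft (E := E) (η v.proj) v.snd).compContinuousLinearMap
      (mfderiv I.tangent I (Bundle.TotalSpace.proj : TangentBundle I X → X) v :
        TangentSpace I.tangent v →L[ℝ] E)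

/-- The tangent (complete) lift `d_T η = d (i_T η) + i_T (d η)` of a form on `X` to `T X`.
For `η = ½ η_{ij}(x) dx^i ∧ dx^j` it is, in the adapted coordinates `(x, ẋ)`,
`½ ẋ^k ∂_k η_{ij} dx^i ∧ dx^j + η_{ij} dẋ^i ∧ dx^j`. -/
def DForm.tangentLift {k : ℕ} (η : DForm I X (k + 1)) :
    DForm I.tangent (TangentBundle I X) (k + 1) :=
  (η.iT I).d I.tangent + (η.d I).iT I

end Forms

/-! ### Contact structures -/

section Contact

variable {F : Type*} [NormedAddCommGroup F] [NormedSpace ℝ F]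
  {K : Type*} [TopologicalSpace K] (J : ModelWithCorners ℝ F K)
  {N : Type*} [TopologicalSpace N] [ChartedSpace K N]

/-- `η` is a contact form at `y`: it does not vanish at `y`, and `dη` is non-degenerate on the
hyperplane `ker η_y`. -/
def IsContactFormAt (η : DForm J N 1) (y : N) : Prop :=
  η y ≠ 0 ∧ ∀ v : TangentSpace J y, η y ![v] = 0 →
    (∀ w : TangentSpace J y, η y ![w] = 0 → η.d J y ![v, w] = 0) → v = 0

/-- A contact structure on a manifold of odd dimension: a field `C` of hyperplanes in the tangent
spaces which is locally the kernel of a smooth contact form. -/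
structure IsContactStructure (C : ∀ y : N, Submodule ℝ (TangentSpace J y)) : Prop where
  odd_dim : Odd (Module.finrank ℝ F)
  locally_ker : ∀ y₀ : N, ∃ U : Set N, IsOpen U ∧ y₀ ∈ U ∧ ∃ η : DForm J N 1,
    η.SmoothOn J U ∧ ∀ y ∈ U, IsContactFormAt J η y ∧
      ∀ v : TangentSpace J y, v ∈ C y ↔ η y ![v] = 0

end Contact

/-! ### Principal bundles with structure group `ℝˣ` -/

section Principal

variable {E : Type*} [NormedAddCommGroup E] [NormedSpace ℝ E]
  {H : Type*} [TopologicalSpace H] (I : ModelWithCorners ℝ E H)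
  {F : Type*} [NormedAddCommGroup F] [NormedSpace ℝ F]
  {K : Type*} [TopologicalSpace K] (J : ModelWithCorners ℝ F K)
  {P : Type*} [TopologicalSpace P] [ChartedSpace H P] [MulAction ℝˣ P]
  {M : Type*} [TopologicalSpace M] [ChartedSpace K M]

/-- `π : P → M` is a smooth principal bundle with structure group `ℝˣ`: the action on `P` is smooth,
preserves the fibres, and around every point of `M` there is a smooth equivariant local
trivialization `π⁻¹(U) ≃ U × ℝˣ`. -/
structure IsPrincipalBundle (π : P → M) : Prop where
  smooth_smul : ContMDiffSMul 𝓘(ℝ, ℝ) I ∞ ℝˣ P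
  smooth_proj : ContMDiff I J ∞ π
  proj_smul : ∀ (s : ℝˣ) (p : P), π (s • p) = π p
  exists_trivialization : ∀ x : M, ∃ e : Bundle.Trivialization ℝˣ π, x ∈ e.baseSet ∧
    ContMDiffOn I (J.prod 𝓘(ℝ, ℝ)) ∞ e e.source ∧
    ContMDiffOn (J.prod 𝓘(ℝ, ℝ)) I ∞ e.toOpenPartialHomeomorph.symm e.target ∧
    ∀ p ∈ e.source, ∀ s : ℝˣ, e (s • p) = ((e p).1, s * (e p).2)

/-- `Ω` is homogeneous of degree `1`: `h_s^* Ω = s Ω` for all `s ∈ ℝˣ`. -/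
def IsHomogeneous {k : ℕ} (Ω : DForm I P k) : Prop :=
  ∀ s : ℝˣ, DForm.pullback I I (fun p : P => s • p) Ω = fun p => (s : ℝ) • Ω p

/-- A symplectic `ℝˣ`-principal bundle: an `ℝˣ`-principal bundle `π : P → M` with a `1`-homogeneous
symplectic form `Ω` on `P`. -/
structure IsSymplecticPrincipalBundle (π : P → M) (Ω : DForm I P 2) : Prop where
  principal : IsPrincipalBundle I J π
  symplectic : IsSymplectic I Ω
  homogeneous : IsHomogeneous I Ω

/-- The Euler vector field `∇_p = d/ds (s • p)` at `s = 1` (`τ ∂_τ` in homogeneous coordinates). -/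
def eulerField (p : P) : TangentSpace I p :=
  (mfderiv 𝓘(ℝ, ℝ) I (fun s : ℝˣ => s • p) 1 (1 : ℝ) : E)

/-- `C` is the field of hyperplanes on `M` corresponding to the symplectic `ℝˣ`-principal bundle
`(π : P → M, Ω)`: its inverse image under `T π` is the kernel of the semi-basic form `i_∇ Ω`.
For `Ω = dτ ∧ η + τ dη` one has `i_∇ Ω = τ η`, so that `C = ker η`. -/
def CorrespondsTo (C : ∀ x : M, Submodule ℝ (TangentSpace J x)) (π : P → M) (Ω : DForm I P 2) :
    Prop :=
  ∀ (p : P) (u : TangentSpace I p),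
    mfderiv I J π p u ∈ C (π p) ↔ Ω p ![eulerField I p, u] = 0

end Principal

/-! ### The lifted action and the Atiyah algebroid -/

section Atiyah

variable {E : Type*} [NormedAddCommGroup E] [NormedSpace ℝ E]
  {H : Type*} [TopologicalSpace H] (I : ModelWithCorners ℝ E H)
  (P : Type*) [TopologicalSpace P] [ChartedSpace H P] [MulAction ℝˣ P]
  [ContMDiffSMul 𝓘(ℝ, ℝ) I ∞ ℝˣ P]

/-- The lifted action `(d_T h)_s = T h_s` of `ℝˣ` on `T P`. -/
instance liftedAction : MulAction ℝˣ (TangentBundle I P) where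
  smul s v := tangentMap I I (fun p : P => s • p) v
  one_smul v := by
    change tangentMap I I (fun p : P => (1 : ℝˣ) • p) v = v
    have h : (fun p : P => (1 : ℝˣ) • p) = id := by ext p; simp
    rw [h, tangentMap_id]; rfl
  mul_smul s t v := by
    change tangentMap I I (fun p : P => (s * t) • p) v =
      tangentMap I I (fun p : P => s • p) (tangentMap I I (fun p : P => t • p) v)
    have hd : ∀ r : ℝˣ, MDifferentiable I I (fun p : P => r • p) := fun r =>
      (ContMDiffSMul.contMDiff_const_smul (I := 𝓘(ℝ, ℝ)) (I' := I) (n := ∞) r).mdifferentiable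
        (by simp)
    have h : (fun p : P => (s * t) • p) = (fun p : P => s • p) ∘ (fun p : P => t • p) := by
      ext p; simp [mul_smul]
    rw [h, tangentMap_comp (hd s) (hd t)]; rfl

/-- The (total space of the) Atiyah algebroid `A P = T P / ℝˣ`: the orbit space of the lifted
action. -/
def AtiyahAlgebroid : Type _ := MulAction.orbitRel.Quotient ℝˣ (TangentBundle I P)

/-- `A P` carries the quotient topology. -/
instance [IsManifold I ∞ P] : TopologicalSpace (AtiyahAlgebroid I P) :=
  inferInstanceAs (TopologicalSpace (Quotient (MulAction.orbitRel ℝˣ (TangentBundle I P))))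

/-- The canonical projection `T P → A P`. -/
def AtiyahAlgebroid.mk (v : TangentBundle I P) : AtiyahAlgebroid I P :=
  Quotient.mk (MulAction.orbitRel ℝˣ (TangentBundle I P)) v

end Atiyah

/-- Two manifold structures (atlases) on the same space define the same smooth structure: the
maximal smooth atlases they generate coincide. -/
def SameSmoothStructure {F : Type*} [NormedAddCommGroup F] [NormedSpace ℝ F]
    {K : Type*} [TopologicalSpace K] (J : ModelWithCorners ℝ F K)
    {N : Type*} [TopologicalSpace N] (c c' : ChartedSpace K N) : Prop :=
  @IsManifold.maximalAtlas ℝ _ F _ _ K _ J ∞ N _ c =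
    @IsManifold.maximalAtlas ℝ _ F _ _ K _ J ∞ N _ c'

end ContactLift

end

open Set Function Filter
open scoped Manifold ContDiff Topology

noncomputable section

/-! A trivialization of `π` gives coordinates `(x, t)` on `P`, `t ≠ 0`, in which `s` acts by `(x, t)
↦ (x, s t)` (`IsPrincipalChart`). In the adapted coordinates `((x, t), (a, b))` on `T P` the lifted
action scales `t` and `b` alike. So `x`, `a`, `b / t` are invariant, and `((x, a, b / t), t)` is a
chart of the same kind on `T P` (`IsPrincipalChart.tangent`).

Whenever such charts cover a space, their invariant components are charts of the orbit space, which
make the orbit map a principal bundle. In any other structure with this property local sections show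
these charts to be smooth, whence uniqueness (`IsOrbitMap.exists_smoothStructure`). `A P` is
Hausdorff because it maps continuously to `M` and each fibre of this map lies in one chart
(`IsOrbitMap.t2Space`); it is second countable as an open quotient of `T P`.

As `Ω` is closed, its tangent lift is `d (i_T Ω)`, hence closed. It is homogeneous because `i_T` and
`d` commute with pull-backs. In coordinates `(z, ż)` the form `i_T Ω` is `Ω_z(ż, dz)`; the vertical
derivatives of its coefficients are the coefficients of `Ω`, so non-degeneracy is inherited
(`IsSymplectic.tangentLift`).

The contact structure comes from a fact about every symplectic `ℝˣ`-bundle with odd-dimensional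
base: in coordinates `(x, t)` homogeneity and closedness force `Ω = dt ∧ η + t dη`, non-degeneracy
makes `η` a contact form, and `i_∇ Ω = t η` has the kernel of `η`
(`IsSymplecticPrincipalBundle.existsUnique_contactStructure`). -/

namespace ContactLift

/-! ### Smooth families of alternating forms. -/

section Alternating

variable {E F G : Type*} [NormedAddCommGroup E] [NormedSpace ℝ E]
  [NormedAddCommGroup F] [NormedSpace ℝ F] [NormedAddCommGroup G] [NormedSpace ℝ G]

/-- An alternating form is determined by its values on tuples of basis vectors. These finitely many
numbers depend smoothly on the point, and a linear left inverse of the evaluation map recovers the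
form from them. -/
theorem contDiffAt_alternating [FiniteDimensional ℝ E] {k : ℕ} {n : ℕ∞ω} {f : G → E [⋀^Fin k]→L[ℝ] ℝ} {x : G}
    (h : ∀ v : Fin k → E, ContDiffAt ℝ n (fun y => f y v) x) : ContDiffAt ℝ n f x := by
  let b := Module.finBasis ℝ E
  let Φ : (E [⋀^Fin k]→L[ℝ] ℝ) →ₗ[ℝ] ((Fin k → Fin (Module.finrank ℝ E)) → ℝ) :=
    { toFun := fun α j => α (fun i => b (j i))
      map_add' := fun _ _ => rfl
      map_smul' := fun _ _ => rfl }
  have hΦ : Injective Φ := by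
    intro α β hαβ
    apply ContinuousAlternatingMap.toAlternatingMap_injective
    exact Module.Basis.ext_alternating b fun j _ => congrFun hαβ j
  obtain ⟨Ψ, hΨ⟩ := Φ.exists_leftInverse_of_injective (LinearMap.ker_eq_bot.2 hΦ)
  have hf : f = fun y => Ψ.toContinuousLinearMap (Φ (f y)) := by
    funext y
    exact (LinearMap.congr_fun hΨ (f y)).symm
  rw [hf]
  refine (ContinuousLinearMap.contDiff _).contDiffAt.comp x ?_
  rw [contDiffAt_pi]
  exact fun j => h fun i => b (j i)

theorem contDiffAt_alternating_apply {k : ℕ} {n : ℕ∞ω} {f : G → E [⋀^Fin k]→L[ℝ] ℝ}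
    {g : G → Fin k → E} {x : G} (hf : ContDiffAt ℝ n f x)
    (hg : ∀ i, ContDiffAt ℝ n (fun y => g y i) x) : ContDiffAt ℝ n (fun y => f y (g y)) x := by
  have h : AnalyticAt ℝ (fun p : (E [⋀^Fin k]→L[ℝ] ℝ) × (Fin k → E) =>
      ContinuousAlternatingMap.toContinuousMultilinearMapCLM ℝ p.1 p.2) (f x, g x) :=
    ContinuousLinearMap.analyticAt_uncurry_of_multilinear _
  exact h.contDiffAt.comp x (hf.prodMk (contDiffAt_pi.2 hg))

theorem contDiffAt_compContinuousLinearMap {k : ℕ} {n : ℕ∞ω} [FiniteDimensional ℝ E]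
    {f : G → F [⋀^Fin k]→L[ℝ] ℝ}
    {L : G → E →L[ℝ] F} {x : G} (hf : ContDiffAt ℝ n f x) (hL : ContDiffAt ℝ n L x) :
    ContDiffAt ℝ n (fun y => (f y).compContinuousLinearMap (L y)) x :=
  contDiffAt_alternating fun v => contDiffAt_alternating_apply (f := f)
    (g := fun y i => L y (v i)) hf fun _ => hL.clm_apply contDiffAt_const

end Alternating

/-! ### Pull-back, smoothness and exterior derivative of forms on manifolds. -/

section Forms

variable {E : Type*} [NormedAddCommGroup E] [NormedSpace ℝ E]
  {H : Type*} [TopologicalSpace H] {I : ModelWithCorners ℝ E H}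
  {X : Type*} [TopologicalSpace X] [ChartedSpace H X]
  {E' : Type*} [NormedAddCommGroup E'] [NormedSpace ℝ E']
  {H' : Type*} [TopologicalSpace H'] {I' : ModelWithCorners ℝ E' H'}
  {X' : Type*} [TopologicalSpace X'] [ChartedSpace H' X']
  {E'' : Type*} [NormedAddCommGroup E''] [NormedSpace ℝ E'']
  {H'' : Type*} [TopologicalSpace H''] {I'' : ModelWithCorners ℝ E'' H''}
  {X'' : Type*} [TopologicalSpace X''] [ChartedSpace H'' X'']

theorem DForm.pullback_apply {k : ℕ} (f : X → X') (η : DForm I' X' k) (x : X)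
    (v : Fin k → TangentSpace I x) :
    DForm.pullback I I' f η x v = η (f x) (fun i => mfderiv I I' f x (v i)) := rfl

theorem DForm.pullback_comp {k : ℕ} {f : X → X'} {g : X' → X''} (η : DForm I'' X'' k) {x : X}
    (hg : MDifferentiableAt I' I'' g (f x)) (hf : MDifferentiableAt I I' f x) :
    DForm.pullback I I'' (g ∘ f) η x = DForm.pullback I I' f (DForm.pullback I' I'' g η) x := by
  ext v
  simp only [DForm.pullback_apply, mfderiv_comp x hg hf]
  rfl

theorem DForm.pullback_congr {k : ℕ} {f g : X → X'} (η : DForm I' X' k) {x : X}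
    (h : f =ᶠ[𝓝 x] g) : DForm.pullback I I' f η x = DForm.pullback I I' g η x := by
  have h1 : (mfderiv I I' f x : E →L[ℝ] E') = mfderiv I I' g x := h.mfderiv_eq
  -- `η (f x)` and `η (g x)` live over different tangent spaces; typing all vectors in the model
  -- spaces allows both equalities to be substituted.
  have h2 : ∀ (y y' : X') (L L' : E →L[ℝ] E'), y = y' → L = L' → ∀ v : Fin k → E,
      (η y : (Fin k → E') → ℝ) (fun i => L (v i)) = (η y' : (Fin k → E') → ℝ) (fun i => L' (v i)) := by
    rintro y _ L _ rfl rfl v; rfl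
  ext v
  exact h2 _ _ _ _ h.self_of_nhds h1 v

theorem DForm.pullback_id {k : ℕ} (η : DForm I X k) (x : X) : DForm.pullback I I id η x = η x := by
  ext v
  simp only [DForm.pullback_apply, mfderiv_id]
  rfl

theorem DForm.pullback_of_leftInverse {k : ℕ} {f : X → X'} {g : X' → X} (η : DForm I X k) {x : X}
    (hg : MDifferentiableAt I' I g (f x)) (hf : MDifferentiableAt I I' f x)
    (h : ∀ᶠ y in 𝓝 x, g (f y) = y) :
    DForm.pullback I I' f (DForm.pullback I' I g η) x = η x := by
  have h1 : DForm.pullback I I (g ∘ f) η x = DForm.pullback I I id η x :=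
    DForm.pullback_congr η h
  rw [← DForm.pullback_comp η hg hf, h1, DForm.pullback_id]


theorem DForm.pullback_congr_form {k : ℕ} (f : X → X') {η η' : DForm I' X' k} {x : X}
    (h : η (f x) = η' (f x)) : DForm.pullback I I' f η x = DForm.pullback I I' f η' x := by
  rw [DForm.pullback, DForm.pullback, h]

/-- A form on a vector space, as a function. -/
def DForm.toFun {k : ℕ} (η : DForm 𝓘(ℝ, E) E k) : E → E [⋀^Fin k]→L[ℝ] ℝ := η

/-- The expression of a form in a preferred chart, as a form on the model vector space. -/
def DForm.chartForm {k : ℕ} (η : DForm I X k) (x : X) : DForm 𝓘(ℝ, E) E k :=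
  DForm.pullback 𝓘(ℝ, E) I (extChartAt I x).symm η

/-- A form is smooth at a point if its expression in the preferred chart there is. -/
def DForm.SmoothAt {k : ℕ} (I : ModelWithCorners ℝ E H) (η : DForm I X k) (x : X) : Prop :=
  ContDiffAt ℝ ∞ (η.chartForm x).toFun (extChartAt I x x)

theorem DForm.toFun_pullback {k : ℕ} (f : E → E') (η : DForm 𝓘(ℝ, E') E' k) (x : E) :
    (DForm.pullback 𝓘(ℝ, E) 𝓘(ℝ, E') f η).toFun x =
      (η.toFun (f x)).compContinuousLinearMap (fderiv ℝ f x) := by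
  rw [← mfderiv_eq_fderiv]; rfl

theorem DForm.d_apply {k : ℕ} (η : DForm I X k) (x : X) (v : Fin (k + 1) → TangentSpace I x) :
    η.d I x v = extDeriv (η.chartForm x).toFun (extChartAt I x x)
      (fun i => (mfderiv I 𝓘(ℝ, E) (extChartAt I x) x : TangentSpace I x →L[ℝ] E) (v i)) := rfl

theorem DForm.chartForm_modelSpace {k : ℕ} (η : DForm 𝓘(ℝ, E) E k) (x : E) :
    η.chartForm x = η := by
  funext y
  exact DForm.pullback_id η y

theorem DForm.smoothAt_modelSpace {k : ℕ} {η : DForm 𝓘(ℝ, E) E k} {x : E} :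
    η.SmoothAt 𝓘(ℝ, E) x ↔ ContDiffAt ℝ ∞ η.toFun x := by
  rw [DForm.SmoothAt, DForm.chartForm_modelSpace]; rfl

theorem DForm.toFun_d {k : ℕ} (η : DForm 𝓘(ℝ, E) E k) :
    (η.d 𝓘(ℝ, E)).toFun = extDeriv η.toFun := by
  funext x
  ext v
  refine (DForm.d_apply η x v).trans ?_
  rw [DForm.chartForm_modelSpace]
  simp [chartAt_self_eq]
  rfl

theorem contMDiffAt_extChartAt_symm [IsManifold I ∞ X] [I.Boundaryless] {x : X} {z : E}
    (hz : z ∈ (extChartAt I x).target) :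
    ContMDiffAt 𝓘(ℝ, E) I ∞ (extChartAt I x).symm z :=
  (contMDiffOn_extChartAt_symm x).contMDiffAt ((isOpen_extChartAt_target x).mem_nhds hz)

theorem tendsto_extChartAt_symm (x : X) :
    Tendsto (extChartAt I x).symm (𝓝 (extChartAt I x x)) (𝓝 x) := by
  have := (continuousAt_extChartAt_symm (I := I) x).tendsto
  rwa [extChartAt_to_inv] at this

theorem eventually_mdifferentiableAt [IsManifold I ∞ X] [IsManifold I' ∞ X'] {f : X → X'} {x : X}
    (hf : ContMDiffAt I I' ∞ f x) : ∀ᶠ y in 𝓝 x, MDifferentiableAt I I' f y := by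
  have : IsManifold I 1 X := IsManifold.of_le (n := ∞) (by simp)
  have : IsManifold I' 1 X' := IsManifold.of_le (n := ∞) (by simp)
  have h1 : ContMDiffAt I I' 1 f x := hf.of_le (by simp)
  exact ((contMDiffAt_iff_contMDiffAt_nhds (by simp)).1 h1).mono
    fun y hy => hy.mdifferentiableAt (by simp)

theorem DForm.SmoothAt.differentiableAt {k : ℕ} {η : DForm I X k} {x : X} (hη : η.SmoothAt I x) :
    DifferentiableAt ℝ (η.chartForm x).toFun (extChartAt I x x) :=
  ContDiffAt.differentiableAt hη (by simp)

theorem DForm.pullback_chartForm [IsManifold I ∞ X] [I.Boundaryless] {k : ℕ} (η : DForm I X k)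
    {x y : X} (hy : y ∈ (chartAt H x).source) :
    DForm.pullback I 𝓘(ℝ, E) (extChartAt I x) (η.chartForm x) y = η y := by
  have hy' : y ∈ (extChartAt I x).source := by rwa [extChartAt_source]
  apply DForm.pullback_of_leftInverse
  · exact (contMDiffAt_extChartAt_symm
      ((extChartAt I x).map_source hy')).mdifferentiableAt (by simp)
  · exact (contMDiffAt_extChartAt' (n := ∞) hy).mdifferentiableAt (by simp)
  · filter_upwards [(isOpen_extChartAt_source x).mem_nhds hy'] with z hz
    exact (extChartAt I x).left_inv hz

theorem contDiffAt_extChartAt_comp [I.Boundaryless] {f : X → X'} {x : X} (hf : ContMDiffAt I I' ∞ f x) :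
    ContDiffAt ℝ ∞ (extChartAt I' (f x) ∘ (f ∘ (extChartAt I x).symm)) (extChartAt I x x) := by
  have := (contMDiffAt_iff.1 hf).2
  rwa [ModelWithCorners.range_eq_univ, contDiffWithinAt_univ] at this

section Boundaryless

variable [IsManifold I ∞ X] [IsManifold I' ∞ X'] [I.Boundaryless] [I'.Boundaryless]

/-- True only near the point, where `f` is differentiable and takes values in the domain of the
chart at `f x`. -/
theorem DForm.chartForm_pullback {k : ℕ} (η : DForm I' X' k) {f : X → X'} {x : X}
    (hf : ContMDiffAt I I' ∞ f x) :
    ∀ᶠ z in 𝓝 (extChartAt I x x), (DForm.pullback I I' f η).chartForm x z =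
      DForm.pullback 𝓘(ℝ, E) 𝓘(ℝ, E')
        (extChartAt I' (f x) ∘ (f ∘ (extChartAt I x).symm)) (η.chartForm (f x)) z := by
  have hc := tendsto_extChartAt_symm (I := I) x
  filter_upwards [(isOpen_extChartAt_target x).mem_nhds (mem_extChartAt_target (I := I) x),
    hc.eventually (eventually_mdifferentiableAt hf),
    hc.eventually (hf.continuousAt.eventually
      ((chartAt H' (f x)).open_source.mem_nhds (mem_chart_source H' (f x))))] with z hz h1 h2
  have hs : MDifferentiableAt 𝓘(ℝ, E) I (extChartAt I x).symm z :=
    (contMDiffAt_extChartAt_symm hz).mdifferentiableAt (by simp)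
  have hψ : MDifferentiableAt I' 𝓘(ℝ, E') (extChartAt I' (f x))
      ((f ∘ (extChartAt I x).symm) z) :=
    (contMDiffAt_extChartAt' (n := ∞) h2).mdifferentiableAt (by simp)
  rw [DForm.pullback_comp _ hψ (h1.comp z hs), DForm.chartForm, ← DForm.pullback_comp η h1 hs]
  exact DForm.pullback_congr_form _ (DForm.pullback_chartForm η h2).symm

theorem DForm.SmoothAt.pullback [FiniteDimensional ℝ E] [FiniteDimensional ℝ E'] {k : ℕ}
    {η : DForm I' X' k} {f : X → X'} {x : X} (hη : η.SmoothAt I' (f x))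
    (hf : ContMDiffAt I I' ∞ f x) : (DForm.pullback I I' f η).SmoothAt I x := by
  have hF := contDiffAt_extChartAt_comp hf
  refine ContDiffAt.congr_of_eventuallyEq ?_ ((DForm.chartForm_pullback η hf).mono
    fun z hz => hz.trans (DForm.toFun_pullback _ _ z))
  refine contDiffAt_compContinuousLinearMap (ContDiffAt.comp (g := (η.chartForm (f x)).toFun)
    (extChartAt I x x) ?_ hF) (hF.fderiv_right (by simp))
  simpa [DForm.SmoothAt] using hη

/-- Naturality of `d` reduces to `extDeriv_pullback` for the coordinate expression `F` of `f`. The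
chart derivatives built into `DForm.d` are matched by the chain rule for the two sides of `F ∘
(chart at x) = (chart at f x) ∘ f`. -/
theorem DForm.d_pullback {k : ℕ} {η : DForm I' X' k} {f : X → X'} {x : X}
    (hη : η.SmoothAt I' (f x)) (hf : ContMDiffAt I I' ∞ f x) :
    (DForm.pullback I I' f η).d I x = DForm.pullback I I' f (η.d I') x := by
  have hF := contDiffAt_extChartAt_comp hf
  have hE := DForm.chartForm_pullback η hf
  set F : E → E' := extChartAt I' (f x) ∘ (f ∘ (extChartAt I x).symm) with hFdef
  have hFx : F (extChartAt I x x) = extChartAt I' (f x) (f x) := by simp [hFdef]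
  have hd : extDeriv ((DForm.pullback I I' f η).chartForm x).toFun (extChartAt I x x) =
      (extDeriv (η.chartForm (f x)).toFun (F (extChartAt I x x))).compContinuousLinearMap
        (fderiv ℝ F (extChartAt I x x)) := by
    have h1 : ((DForm.pullback I I' f η).chartForm x).toFun =ᶠ[𝓝 (extChartAt I x x)]
        fun z => ((η.chartForm (f x)).toFun (F z)).compContinuousLinearMap (fderiv ℝ F z) :=
      hE.mono fun z hz => hz.trans (DForm.toFun_pullback _ _ z)
    rw [h1.extDeriv_eq]
    refine extDeriv_pullback (r := ∞) ?_ hF (by simpa using ENat.LEInfty.out)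
    rw [hFx]
    exact hη.differentiableAt
  have hL : (fderiv ℝ F (extChartAt I x x)).comp
      (mfderiv I 𝓘(ℝ, E) (extChartAt I x) x : E →L[ℝ] E) =
      (mfderiv I' 𝓘(ℝ, E') (extChartAt I' (f x)) (f x) : E' →L[ℝ] E').comp
        (mfderiv I I' f x : E →L[ℝ] E') := by
    have e1 := mfderiv_comp (I := I) (I' := 𝓘(ℝ, E)) (I'' := 𝓘(ℝ, E')) (g := F)
      (f := extChartAt I x) x (hF.contMDiffAt.mdifferentiableAt (by simp))
      ((contMDiffAt_extChartAt (n := ∞)).mdifferentiableAt (by simp))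
    have e2 := mfderiv_comp (I := I) (I' := I') (I'' := 𝓘(ℝ, E')) (g := extChartAt I' (f x))
      (f := f) x ((contMDiffAt_extChartAt (n := ∞)).mdifferentiableAt (by simp))
      (hf.mdifferentiableAt (by simp))
    rw [mfderiv_eq_fderiv] at e1
    refine e1.symm.trans (Eq.trans ?_ e2)
    apply Filter.EventuallyEq.mfderiv_eq
    filter_upwards [(isOpen_extChartAt_source x).mem_nhds (mem_extChartAt_source (I := I) x)]
      with y hy
    simp only [hFdef, comp_apply, (extChartAt I x).left_inv hy]
  ext v
  rw [DForm.pullback_apply]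
  refine (DForm.d_apply _ x v).trans (Eq.trans ?_ (DForm.d_apply η (f x) _).symm)
  rw [hd, hFx]
  exact congrArg _ (funext fun i => DFunLike.congr_fun hL (v i))

/-- `SmoothOn` tests every preferred chart, `SmoothAt` only the one centred at the point; smoothness
of pull-backs by inverse charts bridges the two. -/
theorem DForm.smoothOn_iff [FiniteDimensional ℝ E] {k : ℕ} {η : DForm I X k} {U : Set X}
    (hU : IsOpen U) : η.SmoothOn I U ↔ ∀ x ∈ U, η.SmoothAt I x := by
  constructor
  · intro h x hx
    have h1 : IsOpen ((extChartAt I x).target ∩ (extChartAt I x).symm ⁻¹' U) :=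
      (continuousOn_extChartAt_symm x).isOpen_inter_preimage (isOpen_extChartAt_target x) hU
    exact (h x).contDiffAt (h1.mem_nhds ⟨mem_extChartAt_target x, by simpa using hx⟩)
  · rintro h x₀ z ⟨hz, hzU⟩
    have h1 : (η.chartForm x₀).SmoothAt 𝓘(ℝ, E) z :=
      DForm.SmoothAt.pullback (h _ hzU) (contMDiffAt_extChartAt_symm hz)
    exact (DForm.smoothAt_modelSpace.1 h1).contDiffWithinAt

end Boundaryless

theorem contDiffAt_extDeriv {k : ℕ} {f : E → E [⋀^Fin k]→L[ℝ] ℝ} {z : E}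
    (h : ContDiffAt ℝ ∞ f z) : ContDiffAt ℝ ∞ (extDeriv f) z :=
  (ContinuousAlternatingMap.alternatizeUncurryFinCLM ℝ E ℝ).contDiff.contDiffAt.comp z
    (h.fderiv_right (by simp))

section Boundaryless

variable [IsManifold I ∞ X] [I.Boundaryless]

/-- `DForm.d` uses a different chart at each point. By naturality the single chart at `x` computes
it near `x`, so that it can be differentiated again. -/
theorem DForm.chartForm_d {k : ℕ} {η : DForm I X k} {x : X}
    (h : ∀ᶠ y in 𝓝 x, η.SmoothAt I y) :
    ((η.d I).chartForm x).toFun =ᶠ[𝓝 (extChartAt I x x)] extDeriv (η.chartForm x).toFun := by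
  filter_upwards [(isOpen_extChartAt_target x).mem_nhds (mem_extChartAt_target (I := I) x),
    (tendsto_extChartAt_symm x).eventually h] with z hz h1
  rw [← DForm.toFun_d]
  exact (DForm.d_pullback h1 (contMDiffAt_extChartAt_symm hz)).symm

theorem DForm.SmoothAt.d {k : ℕ} {η : DForm I X k} {x : X}
    (h : ∀ᶠ y in 𝓝 x, η.SmoothAt I y) : (η.d I).SmoothAt I x :=
  (contDiffAt_extDeriv h.self_of_nhds).congr_of_eventuallyEq (DForm.chartForm_d h)

theorem DForm.d_d {k : ℕ} {η : DForm I X k} {x : X}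
    (h : ∀ᶠ y in 𝓝 x, η.SmoothAt I y) : (η.d I).d I x = 0 := by
  ext v
  refine (DForm.d_apply _ x v).trans ?_
  rw [(DForm.chartForm_d h).extDeriv_eq,
    extDeriv_extDeriv_apply (r := ∞) h.self_of_nhds (by simpa using ENat.LEInfty.out)]
  rfl

end Boundaryless

theorem DForm.d_const_smul {k : ℕ} (c : ℝ) (η : DForm I X k) (x : X) :
    DForm.d I (fun y => c • η y) x = c • η.d I x := by
  ext v
  have h : (DForm.chartForm (I := I) (fun y => c • η y) x).toFun = c • (η.chartForm x).toFun := rfl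
  refine (DForm.d_apply _ x v).trans ?_
  rw [h, extDeriv_smul]
  rfl

end Forms

/-! ### Local coordinates with values in an arbitrary normed space. -/

section Coord

variable {E : Type*} [NormedAddCommGroup E] [NormedSpace ℝ E]
  {H : Type*} [TopologicalSpace H] {I : ModelWithCorners ℝ E H}
  {X : Type*} [TopologicalSpace X] [ChartedSpace H X]
  {G : Type*} [NormedAddCommGroup G] [NormedSpace ℝ G]

/-- A smooth local coordinate system with values in a normed space. -/
structure IsSmoothCoord (I : ModelWithCorners ℝ E H) (φ : OpenPartialHomeomorph X G) : Prop where
  smooth : ContMDiffOn I 𝓘(ℝ, G) ∞ φ φ.source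
  smooth_symm : ContMDiffOn 𝓘(ℝ, G) I ∞ φ.symm φ.target

namespace IsSmoothCoord

variable {φ : OpenPartialHomeomorph X G} (hφ : IsSmoothCoord I φ)
include hφ

theorem contMDiffAt {x : X} (hx : x ∈ φ.source) : ContMDiffAt I 𝓘(ℝ, G) ∞ φ x :=
  hφ.smooth.contMDiffAt (φ.open_source.mem_nhds hx)

theorem contMDiffAt_symm {z : G} (hz : z ∈ φ.target) : ContMDiffAt 𝓘(ℝ, G) I ∞ φ.symm z :=
  hφ.smooth_symm.contMDiffAt (φ.open_target.mem_nhds hz)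

theorem mdifferentiableAt {x : X} (hx : x ∈ φ.source) : MDifferentiableAt I 𝓘(ℝ, G) φ x :=
  (hφ.contMDiffAt hx).mdifferentiableAt (by simp)

theorem mdifferentiableAt_symm {z : G} (hz : z ∈ φ.target) :
    MDifferentiableAt 𝓘(ℝ, G) I φ.symm z :=
  (hφ.contMDiffAt_symm hz).mdifferentiableAt (by simp)

theorem mdifferentiable : φ.MDifferentiable I 𝓘(ℝ, G) :=
  ⟨fun _ hx => (hφ.mdifferentiableAt hx).mdifferentiableWithinAt,
    fun _ hz => (hφ.mdifferentiableAt_symm hz).mdifferentiableWithinAt⟩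

theorem mfderiv_symm_mfderiv {x : X} (hx : x ∈ φ.source) (v : TangentSpace I x) :
    (mfderiv 𝓘(ℝ, G) I φ.symm (φ x) : G →L[ℝ] E) (mfderiv I 𝓘(ℝ, G) φ x v) = v :=
  DFunLike.congr_fun (hφ.mdifferentiable.symm_comp_deriv hx) v

theorem mfderiv_mfderiv_symm {z : G} (hz : z ∈ φ.target) (w : G) :
    (mfderiv I 𝓘(ℝ, G) φ (φ.symm z) : E →L[ℝ] G) (mfderiv 𝓘(ℝ, G) I φ.symm z w) = w :=
  DFunLike.congr_fun (hφ.mdifferentiable.comp_symm_deriv hz) w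

theorem pullback_pullback_symm {k : ℕ} (η : DForm I X k) {x : X} (hx : x ∈ φ.source) :
    DForm.pullback I 𝓘(ℝ, G) φ (DForm.pullback 𝓘(ℝ, G) I φ.symm η) x = η x :=
  DForm.pullback_of_leftInverse η (hφ.mdifferentiableAt_symm (φ.map_source hx))
    (hφ.mdifferentiableAt hx) (by
      filter_upwards [φ.open_source.mem_nhds hx] with y hy using φ.left_inv hy)

end IsSmoothCoord

theorem DForm.SmoothAt.congr {k : ℕ} {η η' : DForm I X k} {x : X} (h : η.SmoothAt I x)
    (h' : ∀ᶠ y in 𝓝 x, η' y = η y) : η'.SmoothAt I x :=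
  ContDiffAt.congr_of_eventuallyEq h (((tendsto_extChartAt_symm x).eventually h').mono
    fun _ hz => DForm.pullback_congr_form _ hz)

theorem IsSmoothCoord.smoothAt_iff [IsManifold I ∞ X] [I.Boundaryless] [FiniteDimensional ℝ E]
    [FiniteDimensional ℝ G] {φ : OpenPartialHomeomorph X G} (hφ : IsSmoothCoord I φ) {k : ℕ}
    {η : DForm I X k} {x : X} (hx : x ∈ φ.source) :
    η.SmoothAt I x ↔ ContDiffAt ℝ ∞ (DForm.pullback 𝓘(ℝ, G) I φ.symm η).toFun (φ x) := by
  rw [← DForm.smoothAt_modelSpace]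
  constructor
  · intro h
    refine DForm.SmoothAt.pullback ?_ (hφ.contMDiffAt_symm (φ.map_source hx))
    rwa [φ.left_inv hx]
  · intro h
    refine DForm.SmoothAt.congr (DForm.SmoothAt.pullback h (hφ.contMDiffAt hx)) ?_
    filter_upwards [φ.open_source.mem_nhds hx] with y hy
    exact (hφ.pullback_pullback_symm η hy).symm

/-- The derivative of a form in local coordinates. -/
theorem IsSmoothCoord.toFun_pullback_d [IsManifold I ∞ X] [I.Boundaryless]
    {φ : OpenPartialHomeomorph X G} (hφ : IsSmoothCoord I φ) {k : ℕ}
    {η : DForm I X k} {z : G} (hz : z ∈ φ.target) (h : η.SmoothAt I (φ.symm z)) :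
    (DForm.pullback 𝓘(ℝ, G) I φ.symm (η.d I)).toFun z =
      extDeriv (DForm.pullback 𝓘(ℝ, G) I φ.symm η).toFun z := by
  rw [← DForm.toFun_d]
  exact (DForm.d_pullback h (hφ.contMDiffAt_symm hz)).symm

/-- The preferred chart at `x`, as a partial homeomorphism to the model vector space. -/
def chartCoord (I : ModelWithCorners ℝ E H) [I.Boundaryless] (x : X) :
    OpenPartialHomeomorph X E :=
  (chartAt H x).trans I.toHomeomorph.toOpenPartialHomeomorph

variable [I.Boundaryless]

theorem chartCoord_source (x : X) : (chartCoord I x).source = (chartAt H x).source := by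
  simp [chartCoord]

theorem chartCoord_target (x : X) : (chartCoord I x).target = (extChartAt I x).target := by
  simp [chartCoord, extChartAt, I.range_eq_univ]
  rfl

theorem mem_chartCoord_source (x : X) : x ∈ (chartCoord I x).source := by
  rw [chartCoord_source]; exact mem_chart_source H x

theorem isSmoothCoord_chartCoord [IsManifold I ∞ X] (x : X) :
    IsSmoothCoord I (chartCoord I x) where
  smooth := by
    rw [chartCoord_source]
    exact contMDiffOn_extChartAt
  smooth_symm := by
    rw [chartCoord_target]
    exact contMDiffOn_extChartAt_symm x

end Coord

/-! ### Adapted coordinates on the tangent bundle, and `i_T` in them. -/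

section TangentCoord

variable {E : Type*} [NormedAddCommGroup E] [NormedSpace ℝ E]
  {H : Type*} [TopologicalSpace H] {I : ModelWithCorners ℝ E H}
  {X : Type*} [TopologicalSpace X] [ChartedSpace H X] [IsManifold I ∞ X]
  {G : Type*} [NormedAddCommGroup G] [NormedSpace ℝ G]
  {E' : Type*} [NormedAddCommGroup E'] [NormedSpace ℝ E']
  {H' : Type*} [TopologicalSpace H'] {I' : ModelWithCorners ℝ E' H'}
  {X' : Type*} [TopologicalSpace X'] [ChartedSpace H' X'] [IsManifold I' ∞ X']

theorem contMDiffOn_tangentMap {f : X → X'} {s : Set X} (hs : IsOpen s)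
    (hf : ContMDiffOn I I' ∞ f s) :
    ContMDiffOn I.tangent I'.tangent ∞ (tangentMap I I' f)
      ((Bundle.TotalSpace.proj : TangentBundle I X → X) ⁻¹' s) := by
  have : IsManifold I 1 X := IsManifold.of_le (n := ∞) (by simp)
  have : IsManifold I' 1 X' := IsManifold.of_le (n := ∞) (by simp)
  refine (hf.contMDiffOn_tangentMapWithin (m := ∞) (by simp) hs.uniqueMDiffOn).congr
    fun v hv => ?_
  exact (tangentMapWithin_eq_tangentMap (hs.uniqueMDiffOn _ hv)
    ((hf.contMDiffAt (hs.mem_nhds hv)).mdifferentiableAt (by simp))).symm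

theorem contMDiff_tangentModel :
    ContMDiff 𝓘(ℝ, G).tangent 𝓘(ℝ, G × G) ∞
      (fun v : TangentBundle 𝓘(ℝ, G) G => ((v.proj, v.snd) : G × G)) :=
  (Bundle.contMDiff_proj (TangentSpace 𝓘(ℝ, G))).prodMk_space
    (contMDiff_snd_tangentBundle_modelSpace G 𝓘(ℝ, G))

theorem contMDiff_tangentModel_symm :
    ContMDiff 𝓘(ℝ, G × G) 𝓘(ℝ, G).tangent ∞
      (fun p : G × G => (⟨p.1, p.2⟩ : TangentBundle 𝓘(ℝ, G) G)) := by
  rw [modelWithCornersSelf_prod]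
  exact contMDiff_tangentBundleModelSpaceHomeomorph_symm

/-- The coordinates `(z, ż)` on the tangent bundle adapted to coordinates `z` on the base. -/
def tangentCoord (φ : OpenPartialHomeomorph X G) (hφ : IsSmoothCoord I φ) :
    OpenPartialHomeomorph (TangentBundle I X) (G × G) where
  toFun v := (φ v.proj, (mfderiv I 𝓘(ℝ, G) φ v.proj v.snd : G))
  invFun p := ⟨φ.symm p.1, (mfderiv 𝓘(ℝ, G) I φ.symm p.1 p.2 : E)⟩
  source := Bundle.TotalSpace.proj ⁻¹' φ.source
  target := Prod.fst ⁻¹' φ.target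
  map_source' v hv := φ.map_source hv
  map_target' p hp := φ.map_target hp
  left_inv' := by
    rintro ⟨x, v⟩ hx
    have hx' : x ∈ φ.source := hx
    have h := hφ.mfderiv_symm_mfderiv hx' v
    have key : ∀ y : X, y = x → ∀ w w' : E, w = w' →
      (⟨y, w⟩ : TangentBundle I X) = ⟨x, w'⟩ := by rintro y rfl w w' rfl; rfl
    exact key _ (φ.left_inv hx') _ _ h
  right_inv' := by
    rintro ⟨z, w⟩ hz
    exact Prod.ext (φ.right_inv hz) (hφ.mfderiv_mfderiv_symm hz w)
  open_source := φ.open_source.preimage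
    (Bundle.contMDiff_proj (n := ∞) (IB := I) (TangentSpace I)).continuous
  open_target := φ.open_target.preimage continuous_fst
  continuousOn_toFun :=
    (contMDiff_tangentModel.comp_contMDiffOn
      (contMDiffOn_tangentMap φ.open_source hφ.smooth)).continuousOn
  continuousOn_invFun :=
    ((contMDiffOn_tangentMap φ.open_target hφ.smooth_symm).comp
      contMDiff_tangentModel_symm.contMDiffOn fun _ hp => hp).continuousOn

variable {φ : OpenPartialHomeomorph X G} (hφ : IsSmoothCoord I φ)

theorem isSmoothCoord_tangentCoord : IsSmoothCoord I.tangent (tangentCoord φ hφ) where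
  smooth := contMDiff_tangentModel.comp_contMDiffOn
    (contMDiffOn_tangentMap φ.open_source hφ.smooth)
  smooth_symm := (contMDiffOn_tangentMap φ.open_target hφ.smooth_symm).comp
      contMDiff_tangentModel_symm.contMDiffOn fun _ hp => hp

theorem mdifferentiable_proj :
    MDifferentiable I.tangent I (Bundle.TotalSpace.proj : TangentBundle I X → X) :=
  (Bundle.contMDiff_proj (n := ∞) (IB := I) (TangentSpace I)).mdifferentiable (by simp)

theorem DForm.iT_apply {k : ℕ} (η : DForm I X (k + 1)) (v : TangentBundle I X)
    (A : Fin k → TangentSpace I.tangent v) :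
    η.iT I v A = (η v.proj : (Fin (k + 1) → E) → ℝ) (Matrix.vecCons (v.snd : E) fun i =>
      (mfderiv I.tangent I (Bundle.TotalSpace.proj : TangentBundle I X → X) v (A i) : E)) := rfl

/-- `i_T` commutes with pull-backs. -/
theorem DForm.pullback_tangentMap_iT {k : ℕ} (η : DForm I' X' (k + 1)) {f : X → X'}
    {v : TangentBundle I X} (hf : MDifferentiableAt I I' f v.proj)
    (hT : MDifferentiableAt I.tangent I'.tangent (tangentMap I I' f) v) :
    DForm.pullback I.tangent I'.tangent (tangentMap I I' f) (η.iT I') v =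
      (DForm.pullback I I' f η).iT I v := by
  ext A
  have h1 := mfderiv_comp v (mdifferentiable_proj (I := I') (tangentMap I I' f v)) hT
  have h2 := mfderiv_comp v hf (mdifferentiable_proj (I := I) v)
  have h3 := h1.symm.trans h2
  rw [DForm.pullback_apply, DForm.iT_apply, DForm.iT_apply]
  refine Eq.trans ?_ (DForm.pullback_apply (I := I) f η v.proj _).symm
  refine congrArg (η (f v.proj) : (Fin (k + 1) → E') → ℝ) ?_
  funext i
  refine Fin.cases rfl (fun j => ?_) i
  exact DFunLike.congr_fun h3 (A j)

/-- The form `i_T η` in adapted coordinates. -/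
theorem DForm.pullback_tangentCoord_symm_iT {k : ℕ} (η : DForm I X (k + 1)) {p : G × G}
    (hp : p.1 ∈ φ.target) (u : Fin k → G × G) :
    (DForm.pullback 𝓘(ℝ, G × G) I.tangent (tangentCoord φ hφ).symm (η.iT I)).toFun p u =
      (DForm.pullback 𝓘(ℝ, G) I φ.symm η).toFun p.1 (Matrix.vecCons p.2 fun i => (u i).1) := by
  have hs := (isSmoothCoord_tangentCoord hφ).mdifferentiableAt_symm (z := p) hp
  have h1 := mfderiv_comp p (mdifferentiable_proj (I := I) ((tangentCoord φ hφ).symm p)) hs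
  have h2 := mfderiv_comp (I := 𝓘(ℝ, G × G)) (I' := 𝓘(ℝ, G)) (I'' := I) (g := φ.symm)
    (f := Prod.fst) p (hφ.mdifferentiableAt_symm hp)
    differentiableAt_fst.mdifferentiableAt
  rw [mfderiv_eq_fderiv, fderiv_fst] at h2
  have h3 := h1.symm.trans h2
  refine (DForm.pullback_apply (I := 𝓘(ℝ, G × G)) _ (η.iT I) p u).trans ?_
  rw [DForm.iT_apply]
  refine Eq.trans ?_ (DForm.pullback_apply (I := 𝓘(ℝ, G)) _ η p.1 _).symm
  refine congrArg (η (φ.symm p.1) : (Fin (k + 1) → E) → ℝ) ?_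
  funext i
  refine Fin.cases rfl (fun j => ?_) i
  exact DFunLike.congr_fun h3 (u j)

end TangentCoord

/-! ### Exterior derivatives and alternating forms of low degree. -/

section ExtDeriv

variable {G : Type*} [NormedAddCommGroup G] [NormedSpace ℝ G]

theorem extDeriv_one_apply {f : G → G [⋀^Fin 1]→L[ℝ] ℝ} {x : G} (hf : DifferentiableAt ℝ f x)
    (a b : G) : extDeriv f x ![a, b] =
      fderiv ℝ (fun y => f y ![b]) x a - fderiv ℝ (fun y => f y ![a]) x b := by
  have h0 : Fin.removeNth 0 ![a, b] = ![b] := by funext i; fin_cases i; rfl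
  have h1 : Fin.removeNth 1 ![a, b] = ![a] := by funext i; fin_cases i; rfl
  rw [extDeriv_apply hf, Fin.sum_univ_two, h0, h1]
  simp [sub_eq_add_neg]

theorem extDeriv_two_apply {f : G → G [⋀^Fin 2]→L[ℝ] ℝ} {x : G} (hf : DifferentiableAt ℝ f x)
    (a b c : G) : extDeriv f x ![a, b, c] =
      fderiv ℝ (fun y => f y ![b, c]) x a - fderiv ℝ (fun y => f y ![a, c]) x b
        + fderiv ℝ (fun y => f y ![a, b]) x c := by
  have h0 : Fin.removeNth 0 ![a, b, c] = ![b, c] := by funext i; fin_cases i <;> rfl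
  have h1 : Fin.removeNth 1 ![a, b, c] = ![a, c] := by funext i; fin_cases i <;> rfl
  have h2 : Fin.removeNth 2 ![a, b, c] = ![a, b] := by funext i; fin_cases i <;> rfl
  rw [extDeriv_apply hf, Fin.sum_univ_three, h0, h1, h2]
  simp [sub_eq_add_neg]

/-- The derivative in a direction along which the function is affine. -/
theorem fderiv_apply_of_affine {f : G → ℝ} {x u : G} (hf : DifferentiableAt ℝ f x) (k : ℝ)
    (h : ∀ᶠ t in 𝓝 (0 : ℝ), f (x + t • u) = f x + t * k) : fderiv ℝ f x u = k := by
  rw [← hf.lineDeriv_eq_fderiv]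
  have h1 : HasDerivAt (fun t : ℝ => f x + t * k) k 0 := by
    simpa using ((hasDerivAt_id (0 : ℝ)).mul_const k).const_add (f x)
  exact (h1.congr_of_eventuallyEq h).deriv

theorem alternating_cons_add_smul (α : G [⋀^Fin 2]→L[ℝ] ℝ) (a b c : G) (t : ℝ) :
    α ![a + t • b, c] = α ![a, c] + t * α ![b, c] := by
  have h1 := α.toAlternatingMap.toMultilinearMap.cons_add (fun _ : Fin 1 => c) a (t • b)
  have h2 := α.toAlternatingMap.toMultilinearMap.cons_smul (fun _ : Fin 1 => c) t b
  have e : ∀ z : G, (Fin.cons z fun _ : Fin 1 => c : Fin 2 → G) = ![z, c] := by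
    intro z; funext i; fin_cases i <;> rfl
  simp only [e] at h1 h2
  refine h1.trans ?_
  rw [h2]
  rfl

theorem alternating_swap (α : G [⋀^Fin 2]→L[ℝ] ℝ) (a b : G) : α ![b, a] = -α ![a, b] := by
  have h1 := α.toAlternatingMap.map_swap ![a, b] (i := 0) (j := 1) (by simp)
  have e : ![a, b] ∘ Equiv.swap 0 1 = ![b, a] := by funext i; fin_cases i <;> rfl
  rw [e] at h1
  exact h1

end ExtDeriv

/-! ### Pull-backs in low degree and non-degeneracy in coordinates. -/

section Pullback

variable {E : Type*} [NormedAddCommGroup E] [NormedSpace ℝ E]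
  {H : Type*} [TopologicalSpace H] {I : ModelWithCorners ℝ E H}
  {X : Type*} [TopologicalSpace X] [ChartedSpace H X]
  {E' : Type*} [NormedAddCommGroup E'] [NormedSpace ℝ E']
  {H' : Type*} [TopologicalSpace H'] {I' : ModelWithCorners ℝ E' H'}
  {X' : Type*} [TopologicalSpace X'] [ChartedSpace H' X']
  {G : Type*} [NormedAddCommGroup G] [NormedSpace ℝ G]

theorem DForm.pullback_apply_one (f : X → X') (η : DForm I' X' 1) (x : X)
    (a : TangentSpace I x) : DForm.pullback I I' f η x ![a] = η (f x) ![mfderiv I I' f x a] := by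
  rw [DForm.pullback_apply]
  refine congrArg _ ?_
  funext i; fin_cases i; rfl

theorem DForm.pullback_apply_two (f : X → X') (η : DForm I' X' 2) (x : X)
    (a b : TangentSpace I x) : DForm.pullback I I' f η x ![a, b] =
      η (f x) ![mfderiv I I' f x a, mfderiv I I' f x b] := by
  rw [DForm.pullback_apply]
  refine congrArg _ ?_
  funext i; fin_cases i <;> rfl

theorem IsSmoothCoord.eq_zero_of_pullback_symm {φ : OpenPartialHomeomorph X G}
    (hφ : IsSmoothCoord I φ) {Ω : DForm I X 2} (h : IsSymplectic I Ω) {z : G}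
    (hz : z ∈ φ.target) {w : G}
    (hw : ∀ c : G, (DForm.pullback 𝓘(ℝ, G) I φ.symm Ω).toFun z ![w, c] = 0) : w = 0 := by
  have h0 : (mfderiv 𝓘(ℝ, G) I φ.symm z w : E) = 0 := by
    refine h.nondegenerate (φ.symm z) _ fun v => ?_
    have h1 := (DForm.pullback_apply_two φ.symm Ω z w
      (mfderiv I 𝓘(ℝ, G) φ (φ.symm z) v)).symm.trans (hw _)
    have h2 := hφ.mfderiv_symm_mfderiv (φ.map_target hz) v
    rw [φ.right_inv hz] at h2
    refine Eq.trans (congrArg _ ?_) h1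
    funext i; fin_cases i
    · rfl
    · exact h2.symm
  have h3 := hφ.mfderiv_mfderiv_symm hz w
  rw [← h3]
  exact (congrArg _ h0).trans (map_zero _)

end Pullback

/-! ### Smoothness of the action and of its lift. -/

section Action

variable {E : Type*} [NormedAddCommGroup E] [NormedSpace ℝ E]
  {H : Type*} [TopologicalSpace H] {I : ModelWithCorners ℝ E H}
  {X : Type*} [TopologicalSpace X] [ChartedSpace H X]
  [MulAction ℝˣ X] [ContMDiffSMul 𝓘(ℝ, ℝ) I ∞ ℝˣ X]

theorem contMDiff_smul_left (s : ℝˣ) : ContMDiff I I ∞ (fun p : X => s • p) :=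
  ContMDiffSMul.contMDiff_const_smul (I := 𝓘(ℝ, ℝ)) (I' := I) (n := ∞) s

theorem contMDiff_tangentMap_smul [IsManifold I ∞ X] (s : ℝˣ) :
    ContMDiff I.tangent I.tangent ∞ (fun v : TangentBundle I X => s • v) := by
  rw [← contMDiffOn_univ]
  exact contMDiffOn_tangentMap isOpen_univ (contMDiff_smul_left s).contMDiffOn

end Action

/-! ### The tangent lift of a homogeneous symplectic form. -/

section TangentLift

variable {E : Type*} [NormedAddCommGroup E] [NormedSpace ℝ E]
  {H : Type*} [TopologicalSpace H] {I : ModelWithCorners ℝ E H}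
  {X : Type*} [TopologicalSpace X] [ChartedSpace H X] [IsManifold I ∞ X]

theorem DForm.tangentLift_of_closed {k : ℕ} {η : DForm I X (k + 1)} (h : η.d I = 0) :
    η.tangentLift I = (η.iT I).d I.tangent := by
  have h0 : (0 : DForm I X (k + 2)).iT I = 0 := by
    funext v
    ext A
    rfl
  rw [DForm.tangentLift, h]
  exact (congrArg _ h0).trans (add_zero _)

variable [FiniteDimensional ℝ E] [I.Boundaryless]

theorem DForm.SmoothAt.iT {k : ℕ} {η : DForm I X (k + 1)} (h : ∀ x, η.SmoothAt I x)
    (v : TangentBundle I X) : (η.iT I).SmoothAt I.tangent v := by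
  have hφ := isSmoothCoord_chartCoord (I := I) v.proj
  have hv : v.proj ∈ (chartCoord I v.proj).source := mem_chartCoord_source v.proj
  rw [(isSmoothCoord_tangentCoord hφ).smoothAt_iff (x := v) hv]
  refine contDiffAt_alternating fun u => ?_
  have h1 : ContDiffAt ℝ ∞ (fun p : E × E =>
      (DForm.pullback 𝓘(ℝ, E) I (chartCoord I v.proj).symm η).toFun p.1
        (Matrix.vecCons p.2 fun i => (u i).1)) (tangentCoord _ hφ v) := by
    refine contDiffAt_alternating_apply (f := fun p : E × E =>
      (DForm.pullback 𝓘(ℝ, E) I (chartCoord I v.proj).symm η).toFun p.1)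
      (ContDiffAt.comp _ ((hφ.smoothAt_iff hv).1 (h _)) contDiffAt_fst) fun i => ?_
    refine Fin.cases ?_ (fun j => ?_) i
    · exact contDiffAt_snd
    · exact contDiffAt_const
  refine h1.congr_of_eventuallyEq ?_
  filter_upwards [(tangentCoord _ hφ).open_target.mem_nhds
    ((tangentCoord _ hφ).map_source (x := v) hv)] with p hp
  exact DForm.pullback_tangentCoord_symm_iT hφ η hp u

theorem IsSymplectic.smoothAt {Ω : DForm I X 2} (h : IsSymplectic I Ω) (x : X) : Ω.SmoothAt I x :=
  (DForm.smoothOn_iff isOpen_univ).1 h.smooth x trivial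

/-- In adapted coordinates `β = i_T Ω` has `β_q(u) = Θ_{q.1}(q.2, u.1)`. In the splitting into base
and fibre directions the matrix of `dβ` therefore has a zero vertical block and off-diagonal blocks
given, up to sign, by the non-degenerate `Θ`. -/
theorem IsSymplectic.tangentLift {Ω : DForm I X 2} (h : IsSymplectic I Ω) :
    IsSymplectic I.tangent (Ω.tangentLift I) := by
  have hT := DForm.SmoothAt.iT h.smoothAt
  rw [DForm.tangentLift_of_closed h.closed]
  refine ⟨(DForm.smoothOn_iff isOpen_univ).2 fun v _ => DForm.SmoothAt.d (.of_forall hT), ?_, ?_⟩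
  · funext v
    exact DForm.d_d (.of_forall hT)
  · intro v A hA
    have hφ := isSmoothCoord_chartCoord (I := I) v.proj
    have hv : v.proj ∈ (chartCoord I v.proj).source := mem_chartCoord_source v.proj
    have hΦ := isSmoothCoord_tangentCoord hφ
    set φ := chartCoord I v.proj
    set Φ := tangentCoord φ hφ with hΦdef
    have hv' : v ∈ Φ.source := hv
    have hp : Φ v ∈ Φ.target := Φ.map_source hv'
    set Θ := (DForm.pullback 𝓘(ℝ, E) I φ.symm Ω).toFun with hΘ
    set β := (DForm.pullback 𝓘(ℝ, E × E) I.tangent Φ.symm (Ω.iT I)).toFun with hβ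
    have hβd : DifferentiableAt ℝ β (Φ v) :=
      ((hΦ.smoothAt_iff hv').1 (hT v)).differentiableAt (by simp)
    have hβv : ∀ q : E × E, q.1 ∈ φ.target → ∀ u : E × E, β q ![u] = Θ q.1 ![q.2, u.1] := by
      intro q hq u
      refine (DForm.pullback_tangentCoord_symm_iT hφ Ω hq ![u]).trans ?_
      refine congrArg _ ?_
      funext i; fin_cases i <;> rfl
    have hβd' : ∀ u : E × E, DifferentiableAt ℝ (fun q => β q ![u]) (Φ v) := by
      intro u
      exact (ContDiffAt.differentiableAt (n := ∞) (contDiffAt_alternating_apply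
        ((hΦ.smoothAt_iff hv').1 (hT v)) fun i => contDiffAt_const) (by simp))
    -- vertical derivatives of the coefficients
    have hvert : ∀ (u : E × E) (c : E),
        fderiv ℝ (fun q => β q ![u]) (Φ v) (0, c) = Θ (Φ v).1 ![c, u.1] := by
      intro u c
      -- The coefficient is linear in the fibre coordinate, so it is affine along a vertical line.
      refine fderiv_apply_of_affine (hβd' u) _ (.of_forall fun t => ?_)
      have e : (Φ v + t • ((0, c) : E × E)).1 = (Φ v).1 := by simp
      rw [hβv _ (by rw [e]; exact hp), hβv _ hp, e]
      rw [← alternating_cons_add_smul]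
      rfl
    set a : E × E := (mfderiv I.tangent 𝓘(ℝ, E × E) Φ v A : E × E) with ha
    have hA' : ∀ b : E × E, extDeriv β (Φ v) ![a, b] = 0 := by
      intro b
      have h1 := hΦ.toFun_pullback_d hp (η := Ω.iT I) (hT _)
      rw [← h1]
      refine (DForm.pullback_apply_two (I := 𝓘(ℝ, E × E)) _ _ (Φ v) a b).trans ?_
      have h2 : ∀ (w : TangentBundle I X) (hw : w = v) (A' : E × E), A' = A → ∀ B : E × E,
          ((Ω.iT I).d I.tangent w : (Fin 2 → E × E) → ℝ) ![A', B] = 0 := by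
        rintro w rfl _ rfl B
        exact hA B
      exact h2 _ (Φ.left_inv hv') _ (hΦ.mfderiv_symm_mfderiv hv' A)
        (mfderiv 𝓘(ℝ, E × E) I.tangent Φ.symm (Φ v) b)
    have hnd : ∀ w : E, (∀ c : E, Θ (Φ v).1 ![w, c] = 0) → w = 0 := fun w =>
      hφ.eq_zero_of_pullback_symm h hp
    have hd : ∀ b : E × E, fderiv ℝ (fun q => β q ![b]) (Φ v) a =
        fderiv ℝ (fun q => β q ![a]) (Φ v) b := fun b => by
      have h1 := hA' b
      rwa [extDeriv_one_apply hβd, sub_eq_zero] at h1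
    have hskew : ∀ w c : E, Θ (Φ v).1 ![w, c] = 0 → Θ (Φ v).1 ![c, w] = 0 := fun w c hwc => by
      rw [alternating_swap, hwc, neg_zero]
    -- Testing the kernel vector `a` against vertical vectors `(0, c)`, on which `β` vanishes
    -- identically, isolates `Θ(c, a.1)`.
    have ha1 : a.1 = 0 := hnd _ fun c => hskew _ _ <| by
      rw [← hvert, ← hd]
      have h0 : (fun q => β q ![((0, c) : E × E)]) =ᶠ[𝓝 (Φ v)] fun _ => (0 : ℝ) := by
        filter_upwards [Φ.open_target.mem_nhds hp] with q hq
        rw [hβv q hq]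
        exact ContinuousAlternatingMap.map_coord_zero _ 1 rfl
      rw [h0.fderiv_eq]
      simp
    -- Now `a` is vertical, so the coefficient `β(a)` vanishes identically, and testing against `(c,
    -- 0)` isolates `Θ(a.2, c)`.
    have ha2 : a.2 = 0 := hnd _ fun c => by
      have h1 := hvert (c, 0) a.2
      rw [← h1, ← ha1, Prod.mk.eta, hd]
      have h0 : (fun q => β q ![a]) =ᶠ[𝓝 (Φ v)] fun _ => (0 : ℝ) := by
        filter_upwards [Φ.open_target.mem_nhds hp] with q hq
        rw [hβv q hq, ha1]
        exact ContinuousAlternatingMap.map_coord_zero _ 1 rfl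
      rw [h0.fderiv_eq]
      simp
    have ha0 : a = 0 := Prod.ext ha1 ha2
    have := hΦ.mfderiv_symm_mfderiv hv' A
    rw [← this, ← ha, ha0]
    exact map_zero _

variable [MulAction ℝˣ X] [ContMDiffSMul 𝓘(ℝ, ℝ) I ∞ ℝˣ X]

/-- The lifted action is by tangent maps, and both `i_T` and `d` commute with the corresponding
pull-backs and with scalars. -/
theorem IsHomogeneous.tangentLift {Ω : DForm I X 2} (h : IsSymplectic I Ω)
    (hh : IsHomogeneous I Ω) : IsHomogeneous I.tangent (Ω.tangentLift I) := by
  have hT := DForm.SmoothAt.iT h.smoothAt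
  rw [DForm.tangentLift_of_closed h.closed]
  intro s
  funext v
  have h1 : DForm.pullback I.tangent I.tangent (fun w : TangentBundle I X => s • w) (Ω.iT I) =
      fun w => (s : ℝ) • Ω.iT I w := by
    funext w
    refine (DForm.pullback_tangentMap_iT Ω (f := fun p : X => s • p)
      ((contMDiff_smul_left s).mdifferentiable (by simp) _)
      ((contMDiff_tangentMap_smul s).mdifferentiable (by simp) _)).trans ?_
    rw [hh s]
    ext A
    rfl
  rw [← DForm.d_pullback (hT _) (contMDiff_tangentMap_smul s v), h1, DForm.d_const_smul]

end TangentLift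

/-! ### Principal bundles and principal charts. -/

section Principal

variable {E : Type*} [NormedAddCommGroup E] [NormedSpace ℝ E]
  {H : Type*} [TopologicalSpace H] {I : ModelWithCorners ℝ E H}
  {F : Type*} [NormedAddCommGroup F] [NormedSpace ℝ F]
  {K : Type*} [TopologicalSpace K] {J : ModelWithCorners ℝ F K}
  {P : Type*} [TopologicalSpace P] [ChartedSpace H P] [MulAction ℝˣ P]
  {M : Type*} [TopologicalSpace M] [ChartedSpace K M]
  {G : Type*} [NormedAddCommGroup G] [NormedSpace ℝ G]

namespace IsPrincipalBundle

variable {π : P → M} (hπ : IsPrincipalBundle I J π)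
include hπ

theorem surjective : Surjective π := by
  intro x
  obtain ⟨e, hx, -⟩ := hπ.exists_trivialization x
  exact ⟨e.toOpenPartialHomeomorph.symm (x, 1), e.proj_symm_apply' hx⟩

/-- The section keeps the fibre coordinate of `p` constant in a trivialization. It serves to lift
tangent vectors and to compare smooth structures on the base. -/
theorem exists_local_section (p : P) : ∃ σ : M → P, σ (π p) = p ∧
    ContMDiffAt J I ∞ σ (π p) ∧ ∀ᶠ y in 𝓝 (π p), π (σ y) = y := by
  obtain ⟨e, hx, -, hs, -⟩ := hπ.exists_trivialization (π p)
  have hp : p ∈ e.source := e.mem_source.2 hx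
  have ht : (π p, (e p).2) ∈ e.target := by rw [e.mem_target]; exact hx
  refine ⟨fun y => e.toOpenPartialHomeomorph.symm (y, (e p).2), ?_, ?_, ?_⟩
  · exact (congrArg e.toOpenPartialHomeomorph.symm (e.mk_proj_snd hp)).trans (e.left_inv hp)
  · exact (hs.contMDiffAt (e.open_target.mem_nhds ht)).comp (π p)
      (contMDiffAt_id.prodMk contMDiffAt_const)
  · filter_upwards [e.open_baseSet.mem_nhds hx] with y hy
    exact e.proj_symm_apply' hy

theorem mfderiv_surjective (p : P) : Surjective (mfderiv I J π p : E →L[ℝ] F) := by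
  obtain ⟨σ, hσp, hσ, hπσ⟩ := hπ.exists_local_section p
  intro v
  have h1 := mfderiv_comp (π p) (I := J) (I' := I) (I'' := J) (g := π) (f := σ)
    (hπ.smooth_proj.mdifferentiable (by simp) _) (hσ.mdifferentiableAt (by simp))
  have h2 : π ∘ σ =ᶠ[𝓝 (π p)] id := hπσ
  rw [h2.mfderiv_eq, mfderiv_id, hσp] at h1
  exact ⟨(mfderiv J I σ (π p) : F →L[ℝ] E) v, (DFunLike.congr_fun h1 v).symm⟩

end IsPrincipalBundle

/-- Local coordinates `(x, t)` on a manifold with an action of `ℝˣ`, in which the action is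
`s • (x, t) = (x, s t)` and `t` does not vanish. -/
structure IsPrincipalChart (I : ModelWithCorners ℝ E H) (θ : OpenPartialHomeomorph P (G × ℝ)) :
    Prop extends IsSmoothCoord I θ where
  smul_mem : ∀ (s : ℝˣ) (p : P), p ∈ θ.source → s • p ∈ θ.source
  apply_smul : ∀ (s : ℝˣ) (p : P), p ∈ θ.source → θ (s • p) = ((θ p).1, s * (θ p).2)
  snd_ne_zero : ∀ p ∈ θ.source, (θ p).2 ≠ 0

namespace IsPrincipalChart

variable {θ : OpenPartialHomeomorph P (G × ℝ)} (hθ : IsPrincipalChart I θ)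
include hθ

theorem snd_ne_zero_of_mem_target {z : G × ℝ} (hz : z ∈ θ.target) : z.2 ≠ 0 := by
  have h := hθ.snd_ne_zero _ (θ.map_target hz)
  rwa [θ.right_inv hz] at h

theorem smul_symm (s : ℝˣ) {z : G × ℝ} (hz : z ∈ θ.target) :
    (z.1, s * z.2) ∈ θ.target ∧ θ.symm (z.1, s * z.2) = s • θ.symm z := by
  have h := hθ.apply_smul s _ (θ.map_target hz)
  have hm := hθ.smul_mem s _ (θ.map_target hz)
  rw [θ.right_inv hz] at h
  rw [← h]
  exact ⟨θ.map_source hm, θ.left_inv hm⟩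

theorem mk_mem_target {x : G} {t t' : ℝ} (h : (x, t) ∈ θ.target) (ht' : t' ≠ 0) :
    (x, t') ∈ θ.target := by
  have ht : t ≠ 0 := hθ.snd_ne_zero_of_mem_target h
  have := (hθ.smul_symm (Units.mk0 (t' / t) (div_ne_zero ht' ht)) h).1
  simpa [div_mul_cancel₀ _ ht] using this

end IsPrincipalChart

/-- A trivialization is composed with a chart of the base and with the inclusion of `ℝˣ` in `ℝ`.
That the source is a full preimage `π⁻¹(U)` matters later for the Hausdorff property. -/
theorem IsPrincipalBundle.exists_principalChart [IsManifold J ∞ M] [J.Boundaryless] {π : P → M}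
    (hπ : IsPrincipalBundle I J π) (x₀ : M) :
    ∃ (θ : OpenPartialHomeomorph P (F × ℝ)) (U : Set M), IsPrincipalChart I θ ∧ IsOpen U ∧ x₀ ∈ U ∧
      U ⊆ (chartAt K x₀).source ∧ θ.source = π ⁻¹' U ∧
      ∀ p ∈ θ.source, (θ p).1 = extChartAt J x₀ (π p) := by
  obtain ⟨e, hx, hs, hs', he⟩ := hπ.exists_trivialization x₀
  have hχ := isSmoothCoord_chartCoord (I := J) x₀
  set χ := chartCoord J x₀ with hχdef
  -- The chart of `ℝˣ` is the global open inclusion into `ℝ`.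
  let u : OpenPartialHomeomorph ℝˣ ℝ := chartAt ℝ (1 : ℝˣ)
  have hu : ∀ s : ℝˣ, u s = s := fun s => Units.chartAt_apply
  have husrc : u.source = univ := Units.chartAt_source
  have hu1 : ContMDiffOn 𝓘(ℝ, ℝ) 𝓘(ℝ, ℝ) ∞ u u.source := contMDiffOn_chart
  have hu2 : ContMDiffOn 𝓘(ℝ, ℝ) 𝓘(ℝ, ℝ) ∞ u.symm u.target := contMDiffOn_chart_symm
  let θ : OpenPartialHomeomorph P (F × ℝ) := e.toOpenPartialHomeomorph.trans (χ.prod u)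
  have hsrc : θ.source = π ⁻¹' (e.baseSet ∩ (chartAt K x₀).source) := by
    ext p
    have h1 : p ∈ θ.source ↔ p ∈ e.source ∧ (e p).1 ∈ χ.source ∧ (e p).2 ∈ u.source := by
      simp only [θ, OpenPartialHomeomorph.trans_source, OpenPartialHomeomorph.prod_source]
      rfl
    rw [h1, husrc, e.mem_source, hχdef, chartCoord_source]
    constructor
    · rintro ⟨h2, h3, -⟩
      rw [e.coe_fst' h2] at h3
      exact ⟨h2, h3⟩
    · rintro ⟨h2, h3⟩
      exact ⟨h2, by rwa [e.coe_fst' h2], trivial⟩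
  have happ : ∀ p ∈ θ.source, θ p = (extChartAt J x₀ (π p), ((e p).2 : ℝ)) := by
    intro p hp
    rw [hsrc] at hp
    have : (e p).1 = π p := e.coe_fst' hp.1
    rw [← this, ← hu]
    rfl
  refine ⟨θ, e.baseSet ∩ (chartAt K x₀).source, ?_,
    e.open_baseSet.inter (chartAt K x₀).open_source, ⟨hx, mem_chart_source K x₀⟩,
    inter_subset_right, hsrc, fun p hp => by rw [happ p hp]⟩
  have hmem : ∀ (s : ℝˣ) (p : P), p ∈ θ.source → s • p ∈ θ.source := by
    intro s p hp
    rw [hsrc] at hp ⊢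
    rwa [mem_preimage, hπ.proj_smul]
  refine ⟨⟨?_, ?_⟩, hmem, ?_, ?_⟩
  · have h1 : ContMDiffOn (J.prod 𝓘(ℝ, ℝ)) 𝓘(ℝ, F × ℝ) ∞ (χ.prod u) (χ.source ×ˢ u.source) :=
      (hχ.smooth.comp contMDiffOn_fst fun q hq => hq.1).prodMk_space
        (hu1.comp contMDiffOn_snd fun q hq => hq.2)
    refine h1.comp (hs.mono ?_) ?_
    · exact fun p hp => hp.1
    · exact fun p hp => hp.2
  · have h1 : ContMDiffOn 𝓘(ℝ, F × ℝ) (J.prod 𝓘(ℝ, ℝ)) ∞ (χ.prod u).symm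
        (χ.target ×ˢ u.target) :=
      (hχ.smooth_symm.comp contDiff_fst.contMDiff.contMDiffOn fun q hq => hq.1).prodMk
        (hu2.comp contDiff_snd.contMDiff.contMDiffOn fun q hq => hq.2)
    refine hs'.comp (h1.mono ?_) ?_
    · exact fun p hp => hp.1
    · exact fun p hp => hp.2
  · intro s p hp
    have hpe : p ∈ e.source := hp.1
    rw [happ _ (hmem s p hp), happ p hp, hπ.proj_smul, he p hpe]
    simp
  · intro p hp
    rw [happ p hp]
    exact Units.ne_zero _

end Principal

/-! ### Closed homogeneous 2-forms on `G × ℝ` and contact forms. -/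

section HomogeneousForm

variable {G : Type*} [NormedAddCommGroup G] [NormedSpace ℝ G]

/-- The `1`-form `i_{∂_t} Ω` on the slice `t = 1`. -/
def sliceForm (Ω : G × ℝ → (G × ℝ) [⋀^Fin 2]→L[ℝ] ℝ) (x : G) : G [⋀^Fin 1]→L[ℝ] ℝ :=
  ((Ω (x, 1)).curryLeft (0, 1)).compContinuousLinearMap (.inl ℝ G ℝ)

theorem sliceForm_apply (Ω : G × ℝ → (G × ℝ) [⋀^Fin 2]→L[ℝ] ℝ) (x w : G) :
    sliceForm Ω x ![w] = Ω (x, 1) ![(0, 1), (w, 0)] := by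
  rw [sliceForm, ContinuousAlternatingMap.compContinuousLinearMap_apply,
    ContinuousAlternatingMap.curryLeft_apply_apply]
  refine congrArg _ ?_
  funext i; fin_cases i <;> rfl

theorem alternating_add_smul_right (α : G [⋀^Fin 2]→L[ℝ] ℝ) (a b c : G) (t : ℝ) :
    α ![c, a + t • b] = α ![c, a] + t * α ![c, b] := by
  rw [alternating_swap, alternating_cons_add_smul, alternating_swap α a, alternating_swap α b]
  ring

/-- The component `b` drops out because `(0, 1)` pairs to zero with itself. This is why `i_∇ Ω` is
semi-basic. -/
theorem alternating_euler (α : (G × ℝ) [⋀^Fin 2]→L[ℝ] ℝ) (w : G) (t b : ℝ) :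
    α ![(0, t), (w, b)] = t * α ![(0, 1), (w, 0)] := by
  have h0 : ∀ c, α ![(0, 0), c] = 0 := fun c => ContinuousAlternatingMap.map_coord_zero _ 0 rfl
  have h1 : ∀ c, α ![(0, t), c] = t * α ![(0, 1), c] := fun c => by
    have h := alternating_cons_add_smul α (0, 0) (0, 1) c t
    rw [h0, zero_add] at h
    rw [← h]; simp
  have h2 : α ![(w, b), (0, 1)] = α ![(w, 0), (0, 1)] := by
    have h := alternating_cons_add_smul α (w, 0) (0, 1) (0, 1) b
    have h3 : α ![((0, 1) : G × ℝ), (0, 1)] = 0 :=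
      α.map_eq_zero_of_eq _ (i := 0) (j := 1) rfl (by simp)
    rw [h3, mul_zero, add_zero] at h
    rw [← h]; simp
  rw [h1, alternating_swap, h2, alternating_swap α (w, 0)]

variable {Ω : G × ℝ → (G × ℝ) [⋀^Fin 2]→L[ℝ] ℝ} {x : G}

theorem contDiffAt_sliceForm [FiniteDimensional ℝ G] (h : ContDiffAt ℝ ∞ Ω (x, 1)) :
    ContDiffAt ℝ ∞ (sliceForm Ω) x := by
  refine contDiffAt_alternating fun v => ?_
  have h1 : ∀ y, sliceForm Ω y v = Ω (y, 1) ![(0, 1), (v 0, 0)] := fun y => by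
    rw [← sliceForm_apply]
    refine congrArg _ ?_
    funext i; fin_cases i; rfl
  simp only [h1]
  exact contDiffAt_alternating_apply (ContDiffAt.comp x h (by fun_prop))
    fun i => contDiffAt_const

/-- A closed form with homogeneous coefficients is `t dη + dt ∧ η`. -/
theorem extDeriv_sliceForm [FiniteDimensional ℝ G] (h : ContDiffAt ℝ ∞ Ω (x, 1))
    (hd : extDeriv Ω (x, 1) = 0)
    (hh : ∀ v w : G, ∀ t : ℝ, t ≠ 0 → Ω (x, t) ![(v, 0), (w, 0)] =
      t * Ω (x, 1) ![(v, 0), (w, 0)]) (v w : G) :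
    extDeriv (sliceForm Ω) x ![v, w] = Ω (x, 1) ![(v, 0), (w, 0)] := by
  have hs : DifferentiableAt ℝ (sliceForm Ω) x := (contDiffAt_sliceForm h).differentiableAt (by simp)
  have hΩ : ∀ a b : G × ℝ, DifferentiableAt ℝ (fun y => Ω y ![a, b]) (x, 1) := fun a b =>
    (contDiffAt_alternating_apply (g := fun _ => ![a, b]) h
      fun i => contDiffAt_const).differentiableAt (n := ∞) (by simp)
  -- In `dΩ(∂_t, v, w) = 0` the `t`-derivative of `Ω(v, w)` is `Ω(v, w)` itself by homogeneity; the
  -- two remaining terms form `-dη(v, w)`.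
  have h1 := extDeriv_two_apply (h.differentiableAt (by simp)) (0, 1) (v, 0) (w, 0)
  rw [hd] at h1
  have h2 : fderiv ℝ (fun y => Ω y ![(v, 0), (w, 0)]) (x, 1) (0, 1) =
      Ω (x, 1) ![(v, 0), (w, 0)] := by
    refine fderiv_apply_of_affine (hΩ _ _) _ ?_
    filter_upwards [Ioi_mem_nhds (show (-1 : ℝ) < 0 by norm_num)] with t ht
    have ht' : (1 + t : ℝ) ≠ 0 := by have : (-1 : ℝ) < t := ht; linarith
    have e : ((x, 1) : G × ℝ) + t • (0, 1) = (x, 1 + t) := by simp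
    rw [e, hh v w _ ht']
    ring
  have h3 : ∀ u a : G, fderiv ℝ (fun y => sliceForm Ω y ![a]) x u =
      fderiv ℝ (fun y => Ω y ![(0, 1), (a, 0)]) (x, 1) (u, 0) := by
    intro u a
    simp only [sliceForm_apply]
    have hc : HasFDerivAt (fun y : G => ((y, 1) : G × ℝ)) (.inl ℝ G ℝ) x :=
      (hasFDerivAt_id x).prodMk (hasFDerivAt_const 1 x)
    have := ((hΩ (0, 1) (a, 0)).hasFDerivAt.comp x hc).fderiv
    exact DFunLike.congr_fun this u
  rw [extDeriv_one_apply hs, h3, h3]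
  rw [h2] at h1
  have h4 : (0 : (G × ℝ) [⋀^Fin 3]→L[ℝ] ℝ) ![(0, 1), (v, 0), (w, 0)] = 0 := rfl
  linarith

/-- Non-degeneracy of `dt ∧ η + dη` means that `η` is a contact form. -/
theorem contact_of_nondegenerate {α : (G × ℝ) [⋀^Fin 2]→L[ℝ] ℝ}
    (hα : ∀ w, (∀ c, α ![w, c] = 0) → w = 0) :
    (∃ w : G, α ![(0, 1), (w, 0)] ≠ 0) ∧
    ∀ v : G, α ![(0, 1), (v, 0)] = 0 → (∀ w : G, α ![(0, 1), (w, 0)] = 0 →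
      α ![(v, 0), (w, 0)] = 0) → v = 0 := by
  have h0 : ∃ w : G, α ![(0, 1), (w, 0)] ≠ 0 := by
    by_contra! h
    -- Otherwise `∂_t` would lie in the kernel of `α`.
    have := hα (0, 1) fun c => by
      rw [← Prod.mk.eta (p := c), alternating_euler, h, mul_zero]
    simp at this
  refine ⟨h0, fun v hv hvw => ?_⟩
  obtain ⟨w₀, hw₀⟩ := h0
  -- Write `η = α(∂_t, ·)`. Since `w - r w₀` lies in `ker η`, where `α(v, ·)` vanishes, `α(v, ·)` is
  -- a multiple of `η`.
  have hk : ∀ w : G, α ![(v, 0), (w, 0)] =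
      α ![(0, 1), (w, 0)] / α ![(0, 1), (w₀, 0)] * α ![(v, 0), (w₀, 0)] := by
    intro w
    set r := α ![(0, 1), (w, 0)] / α ![(0, 1), (w₀, 0)] with hr
    have e : ((w + (-r) • w₀, 0) : G × ℝ) = (w, 0) + (-r) • (w₀, 0) := by simp
    have h1 := hvw (w + (-r) • w₀) (by
      rw [e, alternating_add_smul_right, hr]
      field_simp
      ring)
    rw [e, alternating_add_smul_right] at h1
    linarith
  -- With this coefficient `a ∂_t` cancels that multiple of `η`, which puts `(v, a)` in the kernel
  -- of `α`.
  set a : ℝ := -(α ![(v, 0), (w₀, 0)] / α ![(0, 1), (w₀, 0)]) with ha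
  have := hα (v, a) fun c => by
    have e1 : ((v, a) : G × ℝ) = (v, 0) + a • (0, 1) := by simp
    have e2 : c = (c.1, 0) + c.2 • ((0, 1) : G × ℝ) := by simp
    have h1 : α ![(0, 1), c] = α ![(0, 1), (c.1, 0)] := by
      rw [← Prod.mk.eta (p := c), alternating_euler, one_mul]
    have h2 : α ![(v, 0), c] = α ![(v, 0), (c.1, 0)] := by
      rw [e2, alternating_add_smul_right, alternating_swap α (0, 1) (v, 0), hv]
      simp
    rw [e1, alternating_cons_add_smul, h1, h2, hk, ha]
    ring
  exact congrArg Prod.fst this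

end HomogeneousForm

/-! ### The contact structure of a symplectic principal bundle. -/

section Contact

variable {E : Type*} [NormedAddCommGroup E] [NormedSpace ℝ E]
  {H : Type*} [TopologicalSpace H] {I : ModelWithCorners ℝ E H}
  {F : Type*} [NormedAddCommGroup F] [NormedSpace ℝ F]
  {K : Type*} [TopologicalSpace K] {J : ModelWithCorners ℝ F K}
  {P : Type*} [TopologicalSpace P] [ChartedSpace H P] [MulAction ℝˣ P]
  {M : Type*} [TopologicalSpace M] [ChartedSpace K M]
  {G : Type*} [NormedAddCommGroup G] [NormedSpace ℝ G]

/-- The expression of a homogeneous form in a principal chart is homogeneous. -/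
theorem IsPrincipalChart.pullback_smul {θ : OpenPartialHomeomorph P (G × ℝ)}
    (hθ : IsPrincipalChart I θ) (hsm : ContMDiffSMul 𝓘(ℝ, ℝ) I ∞ ℝˣ P)
    {Ω : DForm I P 2} (hΩ : IsHomogeneous I Ω) {z : G × ℝ} (hz : z ∈ θ.target) (s : ℝˣ)
    (u w : G × ℝ) :
    (DForm.pullback 𝓘(ℝ, G × ℝ) I θ.symm Ω).toFun (z.1, s * z.2)
      ![(u.1, s * u.2), (w.1, s * w.2)] =
      s * (DForm.pullback 𝓘(ℝ, G × ℝ) I θ.symm Ω).toFun z ![u, w] := by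
  let m : (G × ℝ) →L[ℝ] (G × ℝ) :=
    (ContinuousLinearMap.fst ℝ G ℝ).prod ((s : ℝ) • ContinuousLinearMap.snd ℝ G ℝ)
  have hm : ∀ z : G × ℝ, m z = (z.1, (s : ℝ) * z.2) := fun z => rfl
  have h1 : θ.symm ∘ m =ᶠ[𝓝 z] (fun p : P => s • p) ∘ θ.symm := by
    filter_upwards [θ.open_target.mem_nhds hz] with y hy
    exact (hθ.smul_symm s hy).2
  have hs : MDifferentiable I I (fun p : P => s • p) :=
    (contMDiff_smul_left s).mdifferentiable (by simp)
  have h2 := DForm.pullback_congr (I := 𝓘(ℝ, G × ℝ)) Ω h1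
  have hmz : m z ∈ θ.target := (hθ.smul_symm s hz).1
  rw [DForm.pullback_comp (I' := 𝓘(ℝ, G × ℝ)) Ω (hθ.mdifferentiableAt_symm hmz)
      m.differentiableAt.mdifferentiableAt,
    DForm.pullback_comp Ω (hs _) (hθ.mdifferentiableAt_symm hz), hΩ s] at h2
  have h3 := congrArg (fun α : (G × ℝ) [⋀^Fin 2]→L[ℝ] ℝ => α ![u, w]) h2
  have h4 := (DForm.pullback_apply_two (I := 𝓘(ℝ, G × ℝ)) (I' := 𝓘(ℝ, G × ℝ)) m
    (DForm.pullback 𝓘(ℝ, G × ℝ) I θ.symm Ω) z u w).symm.trans h3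
  rw [mfderiv_eq_fderiv, m.fderiv] at h4
  exact h4

/-- The Euler vector field in a principal chart is `t ∂_t`. -/
theorem IsPrincipalChart.mfderiv_eulerField {θ : OpenPartialHomeomorph P (G × ℝ)}
    (hθ : IsPrincipalChart I θ) (hsm : ContMDiffSMul 𝓘(ℝ, ℝ) I ∞ ℝˣ P) {p : P}
    (hp : p ∈ θ.source) :
    (mfderiv I 𝓘(ℝ, G × ℝ) θ p (eulerField I p) : G × ℝ) = (0, (θ p).2) := by
  have h1 : ContMDiff 𝓘(ℝ, ℝ) I ∞ (fun s : ℝˣ => s • p) :=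
    hsm.contMDiff_smul.comp (contMDiff_id.prodMk contMDiff_const)
  have h2 := mfderiv_comp (I := 𝓘(ℝ, ℝ)) (I' := I) (I'' := 𝓘(ℝ, G × ℝ)) (g := θ)
    (f := fun s : ℝˣ => s • p) 1
    (by rw [one_smul]; exact hθ.mdifferentiableAt hp) (h1.mdifferentiable (by simp) 1)
  let L : ℝ →L[ℝ] G × ℝ := (ContinuousLinearMap.id ℝ ℝ).smulRight ((0, (θ p).2) : G × ℝ)
  -- In the chart the orbit map is affine in the real number `s`, and the inclusion of the units has
  -- identity derivative at `1`.
  have h3 : θ ∘ (fun s : ℝˣ => s • p) = (fun t : ℝ => ((θ p).1, (0 : ℝ)) + L t) ∘ Units.val := by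
    funext s
    simp [hθ.apply_smul s p hp, L]
  have hL : HasFDerivAt (fun t : ℝ => ((θ p).1, (0 : ℝ)) + L t) L ((1 : ℝˣ) : ℝ) :=
    L.hasFDerivAt.const_add _
  have h4 := mfderiv_comp (I := 𝓘(ℝ, ℝ)) (I' := 𝓘(ℝ, ℝ)) (I'' := 𝓘(ℝ, G × ℝ))
    (g := fun t : ℝ => ((θ p).1, (0 : ℝ)) + L t) (f := (Units.val : ℝˣ → ℝ)) 1
    hL.differentiableAt.mdifferentiableAt
    ((Units.contMDiff_val (n := ∞)).mdifferentiable (by simp) 1)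
  have h5 : (mfderiv 𝓘(ℝ, ℝ) 𝓘(ℝ, ℝ) (Units.val : ℝˣ → ℝ) 1 : ℝ →L[ℝ] ℝ) = .id ℝ ℝ :=
    mfderiv_extChartAt_self (I := 𝓘(ℝ, ℝ)) (x := (1 : ℝˣ))
  rw [mfderiv_eq_fderiv, hL.fderiv] at h4
  have h6 : (mfderiv I 𝓘(ℝ, G × ℝ) θ ((1 : ℝˣ) • p) : E →L[ℝ] G × ℝ) =
      mfderiv I 𝓘(ℝ, G × ℝ) θ p := by rw [one_smul]
  have h7 : (mfderiv 𝓘(ℝ, ℝ) 𝓘(ℝ, G × ℝ) (θ ∘ fun s : ℝˣ => s • p) 1 : ℝ →L[ℝ] G × ℝ) (1 : ℝ) =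
      L 1 := by
    rw [h3]
    refine (DFunLike.congr_fun h4 (1 : ℝ)).trans ?_
    exact congrArg L (DFunLike.congr_fun h5 (1 : ℝ))
  have h8 : L 1 = (0, (θ p).2) := by simp [L]
  refine Eq.trans ?_ (h7.trans h8)
  exact (DFunLike.congr_fun (F := E →L[ℝ] G × ℝ) h6 _).symm.trans
    (DFunLike.congr_fun h2 (1 : ℝ)).symm

/-- The form is the slice form pulled back to the base. The relation `i_∇ Ω = t π^*η` with `t ≠ 0`
identifies the kernels at every point of the fibre. -/
theorem IsSymplecticPrincipalBundle.exists_contactForm [FiniteDimensional ℝ E] [I.Boundaryless]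
    [IsManifold I ∞ P] [FiniteDimensional ℝ F] [J.Boundaryless] [IsManifold J ∞ M]
    {π : P → M} {Ω : DForm I P 2} (h : IsSymplecticPrincipalBundle I J π Ω) (y₀ : M) :
    ∃ U : Set M, IsOpen U ∧ y₀ ∈ U ∧ ∃ η : DForm J M 1, η.SmoothOn J U ∧
      ∀ y ∈ U, IsContactFormAt J η y ∧ ∀ p : P, π p = y → ∀ u : TangentSpace I p,
        Ω p ![eulerField I p, u] = 0 ↔ η (π p) ![mfderiv I J π p u] = 0 := by
  obtain ⟨θ, U, hθ, hU, hy₀, hUc, hsrc, hfst⟩ := h.principal.exists_principalChart y₀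
  have hsm := h.principal.smooth_smul
  have hχ := isSmoothCoord_chartCoord (I := J) y₀
  set χ := chartCoord J y₀ with hχdef
  have hUχ : U ⊆ χ.source := by rwa [hχdef, chartCoord_source]
  set Θ := (DForm.pullback 𝓘(ℝ, F × ℝ) I θ.symm Ω).toFun with hΘ
  let ηc : DForm 𝓘(ℝ, F) F 1 := sliceForm Θ
  have hηc : ηc.toFun = sliceForm Θ := rfl
  have htgt : ∀ p : P, π p ∈ U → (χ (π p), (1 : ℝ)) ∈ θ.target := by
    intro p hp
    have hps : p ∈ θ.source := by rw [hsrc]; exact hp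
    have h1 : χ (π p) = (θ p).1 := (hfst p hps).symm
    rw [h1]
    exact hθ.mk_mem_target (t := (θ p).2) (θ.map_source hps) one_ne_zero
  have hone : ∀ y ∈ U, (χ y, (1 : ℝ)) ∈ θ.target := by
    intro y hy
    obtain ⟨p, rfl⟩ := h.principal.surjective y
    exact htgt p hy
  have hC : ∀ y ∈ U, ContDiffAt ℝ ∞ Θ (χ y, 1) := by
    intro y hy
    have h1 := (hθ.smoothAt_iff (θ.map_target (hone y hy))).1 (h.symplectic.smoothAt _)
    rwa [θ.right_inv (hone y hy)] at h1
  have hhom : ∀ y ∈ U, ∀ s : ℝ, s ≠ 0 → ∀ u w : F × ℝ,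
      Θ (χ y, s) ![(u.1, s * u.2), (w.1, s * w.2)] = s * Θ (χ y, 1) ![u, w] := by
    intro y hy s hs u w
    have h1 := hθ.pullback_smul hsm h.homogeneous (hone y hy) (Units.mk0 s hs) u w
    simpa using h1
  have hdc : ∀ y ∈ U, ∀ v w : F, extDeriv (sliceForm Θ) (χ y) ![v, w] =
      Θ (χ y, 1) ![(v, 0), (w, 0)] := by
    intro y hy v w
    refine extDeriv_sliceForm (hC y hy) ?_ (fun v w t ht => ?_) v w
    · rw [← hθ.toFun_pullback_d (hone y hy) (h.symplectic.smoothAt _), h.symplectic.closed]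
      ext v
      rfl
    · simpa using hhom y hy t ht (v, 0) (w, 0)
  have hηs : ∀ y ∈ U, DForm.SmoothAt 𝓘(ℝ, F) ηc (χ y) := fun y hy =>
    DForm.smoothAt_modelSpace.2 (contDiffAt_sliceForm (hC y hy))
  let η : DForm J M 1 := DForm.pullback J 𝓘(ℝ, F) χ ηc
  have hη : ∀ (y : M) (v : TangentSpace J y), η y ![v] =
      Θ (χ y, 1) ![(0, 1), ((mfderiv J 𝓘(ℝ, F) χ y v : F), 0)] := by
    intro y v
    refine (DForm.pullback_apply_one χ ηc y v).trans ?_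
    exact sliceForm_apply Θ _ _
  have hdη : ∀ y ∈ U, ∀ v w : TangentSpace J y, η.d J y ![v, w] =
      Θ (χ y, 1) ![((mfderiv J 𝓘(ℝ, F) χ y v : F), 0), ((mfderiv J 𝓘(ℝ, F) χ y w : F), 0)] := by
    intro y hy v w
    rw [DForm.d_pullback (hηs y hy) (hχ.contMDiffAt (hUχ hy))]
    refine (DForm.pullback_apply_two χ (ηc.d 𝓘(ℝ, F)) y v w).trans (Eq.trans ?_ (hdc y hy _ _))
    rw [← hηc, ← DForm.toFun_d]
    rfl
  refine ⟨U, hU, hy₀, η, (DForm.smoothOn_iff hU).2 fun y hy =>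
    (hηs y hy).pullback (hχ.contMDiffAt (hUχ hy)), fun y hy => ⟨?_, ?_⟩⟩
  · obtain ⟨⟨w, hw⟩, hnd⟩ := contact_of_nondegenerate (α := Θ (χ y, 1))
      fun w => hθ.eq_zero_of_pullback_symm h.symplectic (hone y hy)
    have hinv : ∀ w : F, ∃ v : TangentSpace J y, (mfderiv J 𝓘(ℝ, F) χ y v : F) = w := fun w =>
      hχ.mdifferentiable.mfderiv_surjective (hUχ hy) w
    constructor
    · intro h0
      obtain ⟨v, rfl⟩ := hinv w
      rw [← hη, h0] at hw
      exact hw rfl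
    · intro v hv hvw
      rw [hη] at hv
      refine hχ.mdifferentiable.mfderiv_injective (hUχ hy) ?_
      refine (hnd _ hv fun w hw => ?_).trans (map_zero _).symm
      obtain ⟨w', rfl⟩ := hinv w
      rw [← hη] at hw
      rw [← hdη y hy]
      exact hvw w' hw
  · rintro p rfl u
    have hps : p ∈ θ.source := by rw [hsrc]; exact hy
    have ht := hθ.snd_ne_zero p hps
    have hx : (θ p).1 = χ (π p) := hfst p hps
    have h1 : (mfderiv J 𝓘(ℝ, F) χ (π p) (mfderiv I J π p u) : F) =
        (mfderiv I 𝓘(ℝ, F × ℝ) θ p u : F × ℝ).1 := by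
      have e1 := mfderiv_comp p (hχ.mdifferentiableAt (hUχ hy))
        (h.principal.smooth_proj.mdifferentiable (by simp) p)
      have e2 := mfderiv_comp (I := I) (I' := 𝓘(ℝ, F × ℝ)) (I'' := 𝓘(ℝ, F)) (g := Prod.fst)
        (f := θ) p differentiableAt_fst.mdifferentiableAt (hθ.mdifferentiableAt hps)
      rw [mfderiv_eq_fderiv, fderiv_fst] at e2
      have e3 : χ ∘ π =ᶠ[𝓝 p] Prod.fst ∘ θ := by
        filter_upwards [θ.open_source.mem_nhds hps] with q hq using (hfst q hq).symm
      rw [e3.mfderiv_eq] at e1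
      exact DFunLike.congr_fun (e1.symm.trans e2) u
    have h2 : Ω p ![eulerField I p, u] = (θ p).2 * η (π p) ![mfderiv I J π p u] := by
      rw [← hθ.pullback_pullback_symm Ω hps]
      refine (DForm.pullback_apply_two θ _ p _ u).trans ?_
      rw [hθ.mfderiv_eulerField hsm hps, hη, h1]
      set w : F × ℝ := mfderiv I 𝓘(ℝ, F × ℝ) θ p u
      -- Scaling by `t` carries `∂_t` on the slice `t = 1` to the Euler vector at height `t`.
      have h3 := hhom (π p) hy (θ p).2 ht (0, 1) (w.1, 0)
      rw [← h3, ← hx]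
      simp only [mul_one, mul_zero, Prod.mk.eta]
      exact (alternating_euler (Θ (θ p)) w.1 _ w.2).trans (alternating_euler _ w.1 _ 0).symm
    rw [h2, mul_eq_zero, or_iff_right ht]

/-- The hyperplane field of a symplectic principal bundle is a contact structure. -/
theorem IsSymplecticPrincipalBundle.existsUnique_contactStructure [FiniteDimensional ℝ E]
    [I.Boundaryless] [IsManifold I ∞ P] [FiniteDimensional ℝ F] [J.Boundaryless]
    [IsManifold J ∞ M] {π : P → M} {Ω : DForm I P 2} (h : IsSymplecticPrincipalBundle I J π Ω)
    (hodd : Odd (Module.finrank ℝ F)) :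
    ∃! C : ∀ y : M, Submodule ℝ (TangentSpace J y),
      IsContactStructure J C ∧ CorrespondsTo I J C π Ω := by
  choose U hU hyU η hηs hη using h.exists_contactForm
  let ℓ : ∀ y : M, TangentSpace J y →ₗ[ℝ] ℝ := fun y =>
    ((ContinuousAlternatingMap.ofSubsingleton ℝ (TangentSpace J y) ℝ (0 : Fin 1)).symm
      (η y y)).toLinearMap
  have hℓ : ∀ (y : M) (v : TangentSpace J y), v ∈ LinearMap.ker (ℓ y) ↔ η y y ![v] = 0 := by
    intro y v
    have e : (fun _ : Fin 1 => v) = ![v] := by funext i; fin_cases i; rfl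
    rw [← e]
    rfl
  refine ⟨fun y => LinearMap.ker (ℓ y), ⟨⟨hodd, fun y₀ => ⟨U y₀, hU y₀, hyU y₀, η y₀, hηs y₀,
    fun y hy => ⟨(hη y₀ y hy).1, fun v => ?_⟩⟩⟩, fun p u => ?_⟩, ?_⟩
  -- The forms chosen at different base points may differ, but since `π` and `T π` are surjective,
  -- `Ω` determines their common kernel; the same argument gives uniqueness.
  · obtain ⟨p, rfl⟩ := h.principal.surjective y
    obtain ⟨u, rfl⟩ := h.principal.mfderiv_surjective p v
    exact (hℓ _ _).trans (((hη (π p) (π p) (hyU _)).2 p rfl u).symm.trans ((hη y₀ (π p) hy).2 p rfl u))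
  · exact (hℓ _ _).trans ((hη (π p) (π p) (hyU _)).2 p rfl u).symm
  · rintro C ⟨-, hC⟩
    funext y
    ext v
    obtain ⟨p, rfl⟩ := h.principal.surjective y
    obtain ⟨u, rfl⟩ := h.principal.mfderiv_surjective p v
    exact (hC p u).trans (((hη (π p) (π p) (hyU _)).2 p rfl u).trans (hℓ _ _).symm)

end Contact

/-! ### Smooth structure on the orbit space of an action covered by principal charts. -/

section Quotient

variable {E : Type*} [NormedAddCommGroup E] [NormedSpace ℝ E]
  {H : Type*} [TopologicalSpace H] {I : ModelWithCorners ℝ E H}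
  {Q : Type*} [TopologicalSpace Q] [ChartedSpace H Q] [MulAction ℝˣ Q]
  {G : Type*} [NormedAddCommGroup G] [NormedSpace ℝ G]
  {L : Type*} [TopologicalSpace L] (J : ModelWithCorners ℝ G L)
  {A : Type*} [TopologicalSpace A]

/-- `mk : Q → A` exhibits `A` as the orbit space of the action of `ℝˣ` on `Q`. -/
structure IsOrbitMap (mk : Q → A) : Prop where
  isOpenQuotientMap : IsOpenQuotientMap mk
  eq_iff : ∀ q q' : Q, mk q = mk q' ↔ ∃ s : ℝˣ, s • q = q'

/-- In a principal chart the action is the polynomial map `(s, (x, t)) ↦ (x, s t)`. -/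
theorem contMDiffSMul_of_principalCharts
    (hcov : ∀ q : Q, ∃ θ : OpenPartialHomeomorph Q (G × ℝ), IsPrincipalChart I θ ∧ q ∈ θ.source) :
    ContMDiffSMul 𝓘(ℝ, ℝ) I ∞ ℝˣ Q where
  contMDiff_smul := by
    rintro ⟨s, q⟩
    obtain ⟨θ, hθ, hq⟩ := hcov q
    have h1 : ContMDiffAt (𝓘(ℝ, ℝ).prod I) 𝓘(ℝ, G × ℝ) ∞
        (fun p : ℝˣ × Q => ((θ p.2).1, (p.1 : ℝ) * (θ p.2).2)) (s, q) := by
      have hθ2 : ContMDiffAt (𝓘(ℝ, ℝ).prod I) 𝓘(ℝ, G × ℝ) ∞ (fun p : ℝˣ × Q => θ p.2) (s, q) :=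
        (hθ.contMDiffAt hq).comp (s, q) contMDiffAt_snd
      have hs : ContMDiffAt (𝓘(ℝ, ℝ).prod I) 𝓘(ℝ, ℝ) ∞ (fun p : ℝˣ × Q => (p.1 : ℝ)) (s, q) :=
        (Units.contMDiff_val.contMDiffAt).comp (s, q) contMDiffAt_fst
      have hg : ContDiff ℝ ∞ (fun z : ℝ × (G × ℝ) => (z.2.1, z.1 * z.2.2)) := by fun_prop
      exact hg.contMDiff.contMDiffAt.comp (s, q) (hs.prodMk_space hθ2)
    have h2 : ((θ q).1, (s : ℝ) * (θ q).2) ∈ θ.target := by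
      rw [← hθ.apply_smul s q hq]
      exact θ.map_source (hθ.smul_mem s q hq)
    refine ((hθ.contMDiffAt_symm h2).comp (s, q) h1).congr_of_eventuallyEq ?_
    filter_upwards [continuousAt_snd.preimage_mem_nhds (θ.open_source.mem_nhds hq)] with p hp
    have := hθ.apply_smul p.1 p.2 hp
    rw [comp_apply, ← this, θ.left_inv (hθ.smul_mem _ _ hp)]

variable {mk : Q → A} (hmk : IsOrbitMap mk)
  {θ : OpenPartialHomeomorph Q (G × ℝ)} (hθ : IsPrincipalChart I θ)

include hmk in
theorem IsOrbitMap.smul (s : ℝˣ) (q : Q) : mk (s • q) = mk q :=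
  ((hmk.eq_iff q (s • q)).2 ⟨s, rfl⟩).symm

include hmk hθ in
theorem IsOrbitMap.preimage_image_source : mk ⁻¹' (mk '' θ.source) = θ.source := by
  refine Subset.antisymm ?_ (subset_preimage_image mk _)
  rintro q ⟨q', hq', h⟩
  obtain ⟨s, rfl⟩ := (hmk.eq_iff _ _).1 h
  exact hθ.smul_mem s _ hq'

include hmk hθ in
-- Acting by the inverse of the last coordinate moves a point to the slice `t = 1`, so this slice
-- represents every orbit in the chart.
theorem IsOrbitMap.mk_symm_one {q : Q} (hq : q ∈ θ.source) :
    ((θ q).1, (1 : ℝ)) ∈ θ.target ∧ mk (θ.symm ((θ q).1, 1)) = mk q := by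
  have h0 := hθ.snd_ne_zero q hq
  have h1 := hθ.smul_symm (Units.mk0 _ h0)⁻¹ (θ.map_source hq)
  rw [Units.val_inv_eq_inv_val, Units.val_mk0, inv_mul_cancel₀ h0, θ.left_inv hq] at h1
  exact ⟨h1.1, by rw [h1.2, hmk.smul]⟩

/-- The value at an orbit of the chart induced by a principal chart. -/
def orbitCoord (hmk : IsOrbitMap mk) (θ : OpenPartialHomeomorph Q (G × ℝ)) (a : A) : L :=
  J.symm (θ (surjInv hmk.isOpenQuotientMap.surjective a)).1

include hθ in
-- The first component of `θ` is invariant, so the representative picked by `surjInv` is immaterial.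
theorem orbitCoord_mk {q : Q} (hq : q ∈ θ.source) :
    orbitCoord J hmk θ (mk q) = J.symm (θ q).1 := by
  have h := surjInv_eq hmk.isOpenQuotientMap.surjective (mk q)
  obtain ⟨s, hs⟩ := (hmk.eq_iff _ _).1 h.symm
  rw [orbitCoord, ← hs, hθ.apply_smul s q hq]

variable [J.Boundaryless]

theorem apply_symm_of_boundaryless (x : G) : J (J.symm x) = x :=
  J.right_inv (by rw [J.range_eq_univ]; trivial)

/-- The chart of the orbit space induced by a principal chart. -/
def orbitChart (hmk : IsOrbitMap mk) (hθ : IsPrincipalChart I θ) : OpenPartialHomeomorph A L where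
  toFun := orbitCoord J hmk θ
  invFun l := mk (θ.symm (J l, 1))
  source := mk '' θ.source
  target := {l | (J l, (1 : ℝ)) ∈ θ.target}
  map_source' := by
    rintro _ ⟨q, hq, rfl⟩
    rw [orbitCoord_mk J hmk hθ hq, mem_ofPred_eq, apply_symm_of_boundaryless]
    exact (hmk.mk_symm_one hθ hq).1
  map_target' l hl := ⟨_, θ.map_target hl, rfl⟩
  left_inv' := by
    rintro _ ⟨q, hq, rfl⟩
    rw [orbitCoord_mk J hmk hθ hq, apply_symm_of_boundaryless]
    exact (hmk.mk_symm_one hθ hq).2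
  right_inv' l hl := by
    rw [orbitCoord_mk J hmk hθ (θ.map_target hl), θ.right_inv hl, J.left_inv]
  open_source := hmk.isOpenQuotientMap.isOpenMap _ θ.open_source
  open_target := θ.open_target.preimage (by fun_prop)
  continuousOn_toFun := by
    rintro _ ⟨q, hq, rfl⟩
    refine ContinuousAt.continuousWithinAt ?_
    rw [← hmk.isOpenQuotientMap.continuousAt_comp_iff]
    have h1 : ContinuousAt (fun q => J.symm (θ q).1) q :=
      J.continuous_symm.continuousAt.comp (continuousAt_fst.comp (θ.continuousAt hq))
    refine h1.congr ?_
    filter_upwards [θ.open_source.mem_nhds hq] with q' hq'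
    exact (orbitCoord_mk J hmk hθ hq').symm
  continuousOn_invFun := hmk.isOpenQuotientMap.continuous.comp_continuousOn
    (θ.continuousOn_symm.comp (by fun_prop) fun _ hl => hl)

theorem orbitChart_mk {q : Q} (hq : q ∈ θ.source) :
    orbitChart J hmk hθ (mk q) = J.symm (θ q).1 := orbitCoord_mk J hmk hθ hq

theorem orbitChart_symm_apply (l : L) :
    (orbitChart J hmk hθ).symm l = mk (θ.symm (J l, 1)) := rfl

theorem mem_orbitChart_source {q : Q} :
    mk q ∈ (orbitChart J hmk hθ).source ↔ q ∈ θ.source := by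
  change q ∈ mk ⁻¹' (mk '' θ.source) ↔ _
  rw [hmk.preimage_image_source hθ]

/-- Up to `J`, the transition reads the slice `t = 1` of one principal chart through the invariant
component of the other: `y ↦ (θ' (θ.symm (y, 1))).1`. -/
theorem contDiffOn_orbitChart_transition {θ' : OpenPartialHomeomorph Q (G × ℝ)}
    (hθ' : IsPrincipalChart I θ') :
    ContDiffOn ℝ ∞ (J ∘ (orbitChart J hmk hθ).symm.trans (orbitChart J hmk hθ') ∘ J.symm)
      (J.symm ⁻¹' ((orbitChart J hmk hθ).symm.trans (orbitChart J hmk hθ')).source ∩ range J) := by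
  intro x hx
  have hx1 : (x, (1 : ℝ)) ∈ θ.target := by
    have := hx.1.1
    change (J (J.symm x), (1 : ℝ)) ∈ θ.target at this
    rwa [apply_symm_of_boundaryless] at this
  have hx2 : θ.symm (x, 1) ∈ θ'.source := by
    have := hx.1.2
    change mk (θ.symm (J (J.symm x), 1)) ∈ (orbitChart J hmk hθ').source at this
    rwa [mem_orbitChart_source, apply_symm_of_boundaryless] at this
  have hc : ContinuousAt (fun y : G => ((y, 1) : G × ℝ)) x := by fun_prop
  have h1 : ContMDiffAt 𝓘(ℝ, G) 𝓘(ℝ, G) ∞ (fun y : G => (θ' (θ.symm (y, 1))).1) x := by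
    have e1 : ContMDiffAt 𝓘(ℝ, G) 𝓘(ℝ, G × ℝ) ∞ (fun y : G => ((y, 1) : G × ℝ)) x :=
      (contDiff_id.prodMk contDiff_const).contMDiff.contMDiffAt
    have e2 := (hθ'.contMDiffAt hx2).comp x ((hθ.contMDiffAt_symm hx1).comp x e1)
    exact contDiff_fst.contMDiff.contMDiffAt.comp x e2
  refine (contMDiffAt_iff_contDiffAt.1 h1).contDiffWithinAt.congr_of_eventuallyEq_of_mem ?_ hx
  refine Filter.Eventually.filter_mono nhdsWithin_le_nhds ?_
  have hc2 : ContinuousAt (fun y : G => θ.symm (y, 1)) x :=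
    (θ.continuousAt_symm hx1).comp (f := fun y : G => ((y, 1) : G × ℝ)) hc
  filter_upwards [hc2.preimage_mem_nhds (θ'.open_source.mem_nhds hx2)] with y hy
  simp only [comp_apply, OpenPartialHomeomorph.coe_trans, orbitChart_symm_apply,
    apply_symm_of_boundaryless]
  rw [orbitChart_mk J hmk hθ' hy, apply_symm_of_boundaryless]

theorem unitsChart_symm {t : ℝ} (ht : t ≠ 0) :
    t ∈ (chartAt ℝ (1 : ℝˣ)).target ∧ ((chartAt ℝ (1 : ℝˣ)).symm t : ℝ) = t := by
  have h1 : t ∈ (chartAt ℝ (1 : ℝˣ)).target := by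
    have h2 := (chartAt ℝ (1 : ℝˣ)).map_source (x := Units.mk0 t ht)
      (by rw [Units.chartAt_source]; trivial)
    rwa [Units.chartAt_apply] at h2
  exact ⟨h1, by rw [← Units.chartAt_apply (a := (1 : ℝˣ)), OpenPartialHomeomorph.right_inv _ h1]⟩

theorem IsPrincipalChart.mem_target_of_orbit (hθ : IsPrincipalChart I θ) {a : A}
    (ha : a ∈ mk '' θ.source) {t : ℝ} (ht : t ≠ 0) :
    (J (orbitCoord J hmk θ a), t) ∈ θ.target ∧ mk (θ.symm (J (orbitCoord J hmk θ a), t)) = a := by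
  obtain ⟨q, hq, rfl⟩ := ha
  rw [orbitCoord_mk J hmk hθ hq, apply_symm_of_boundaryless]
  have h1 := hmk.mk_symm_one hθ hq
  have h2 := hθ.smul_symm (Units.mk0 t ht) h1.1
  simp only [Units.val_mk0, mul_one] at h2
  exact ⟨h2.1, by rw [h2.2, hmk.smul, h1.2]⟩

/-- The local trivialization of `mk` induced by a principal chart. -/
def orbitTrivialization (hmk : IsOrbitMap mk) (hθ : IsPrincipalChart I θ) :
    Bundle.Trivialization ℝˣ mk where
  toFun q := (mk q, (chartAt ℝ (1 : ℝˣ)).symm (θ q).2)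
  invFun p := θ.symm (J (orbitCoord J hmk θ p.1), (p.2 : ℝ))
  source := θ.source
  target := (mk '' θ.source) ×ˢ univ
  map_source' q hq := ⟨⟨q, hq, rfl⟩, trivial⟩
  map_target' p hp := θ.map_target (hθ.mem_target_of_orbit J hmk hp.1 p.2.ne_zero).1
  left_inv' q hq := by
    have h : (orbitCoord J hmk θ (mk q)) = J.symm (θ q).1 := orbitCoord_mk J hmk hθ hq
    simp only [h, apply_symm_of_boundaryless]
    rw [(unitsChart_symm (hθ.snd_ne_zero q hq)).2, Prod.mk.eta, θ.left_inv hq]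
  right_inv' := by
    rintro ⟨a, s⟩ hp
    have h := hθ.mem_target_of_orbit J hmk hp.1 s.ne_zero
    refine Prod.ext h.2 ?_
    dsimp only
    rw [θ.right_inv h.1]
    exact Units.ext (unitsChart_symm s.ne_zero).2
  open_source := θ.open_source
  open_target := (hmk.isOpenQuotientMap.isOpenMap _ θ.open_source).prod isOpen_univ
  continuousOn_toFun := by
    refine hmk.isOpenQuotientMap.continuous.continuousOn.prodMk ?_
    exact (chartAt ℝ (1 : ℝˣ)).continuousOn_symm.comp
      (continuous_snd.comp_continuousOn θ.continuousOn)
      fun q hq => (unitsChart_symm (hθ.snd_ne_zero q hq)).1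
  continuousOn_invFun := by
    refine θ.continuousOn_symm.comp (t := θ.target) ?_
      fun p hp => (hθ.mem_target_of_orbit J hmk hp.1 p.2.ne_zero).1
    refine ContinuousOn.prodMk ?_ (Units.continuous_val.comp continuous_snd).continuousOn
    exact J.continuous.comp_continuousOn ((orbitChart J hmk hθ).continuousOn.comp
      continuous_fst.continuousOn fun p hp => hp.1)
  baseSet := mk '' θ.source
  open_baseSet := hmk.isOpenQuotientMap.isOpenMap _ θ.open_source
  source_eq := (hmk.preimage_image_source hθ).symm
  target_eq := rfl
  proj_toFun _ _ := rfl

section Smooth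

variable [ChartedSpace L A] [IsManifold J ∞ A]

omit [IsManifold J ∞ A] in
theorem contMDiffAt_of_orbitChart (hψ : orbitChart J hmk hθ ∈ IsManifold.maximalAtlas J ∞ A)
    {q : Q} (hq : q ∈ θ.source) : ContMDiffAt I J ∞ mk q := by
  have h1 : ContMDiffAt I 𝓘(ℝ, G) ∞ (fun q' => (θ q').1) q :=
    contDiff_fst.contMDiff.contMDiffAt.comp q (hθ.contMDiffAt hq)
  have h2 : ContMDiffAt I J ∞ (fun q' => J.symm (θ q').1) q := by
    have : ContMDiffOn 𝓘(ℝ, G) J ∞ J.symm (range J) := J.contMDiffOn_symm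
    rw [J.range_eq_univ, contMDiffOn_univ] at this
    exact this.contMDiffAt.comp q h1
  have h3 : J.symm (θ q).1 ∈ (orbitChart J hmk hθ).target := by
    rw [← orbitChart_mk J hmk hθ hq]
    exact (orbitChart J hmk hθ).map_source ⟨q, hq, rfl⟩
  refine ((contMDiffAt_symm_of_mem_maximalAtlas hψ h3).comp q h2).congr_of_eventuallyEq ?_
  filter_upwards [θ.open_source.mem_nhds hq] with q' hq'
  rw [comp_apply, ← orbitChart_mk J hmk hθ hq', (orbitChart J hmk hθ).left_inv ⟨q', hq', rfl⟩]

omit [IsManifold J ∞ A] in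
/-- The orbit map is a principal bundle when the base carries the charts induced by principal
charts. -/
theorem IsOrbitMap.isPrincipalBundle
    (hcov : ∀ q : Q, ∃ (θ : OpenPartialHomeomorph Q (G × ℝ)) (hθ : IsPrincipalChart I θ),
      q ∈ θ.source ∧ orbitChart J hmk hθ ∈ IsManifold.maximalAtlas J ∞ A) :
    IsPrincipalBundle I J mk where
  smooth_smul := contMDiffSMul_of_principalCharts fun q =>
    let ⟨θ, hθ, hq, _⟩ := hcov q
    ⟨θ, hθ, hq⟩
  smooth_proj q :=
    let ⟨_, hθ, hq, hψ⟩ := hcov q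
    contMDiffAt_of_orbitChart J hmk hθ hψ hq
  proj_smul := hmk.smul
  exists_trivialization a := by
    obtain ⟨q, rfl⟩ := hmk.isOpenQuotientMap.surjective a
    obtain ⟨θ, hθ, hq, hψ⟩ := hcov q
    refine ⟨orbitTrivialization J hmk hθ, ⟨q, hq, rfl⟩, ?_, ?_, ?_⟩
    · refine ContMDiffOn.prodMk (fun q' hq' =>
        (contMDiffAt_of_orbitChart J hmk hθ hψ hq').contMDiffWithinAt) ?_
      have h1 : ContMDiffOn 𝓘(ℝ, ℝ) 𝓘(ℝ, ℝ) ∞ (chartAt ℝ (1 : ℝˣ)).symm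
        (chartAt ℝ (1 : ℝˣ)).target := contMDiffOn_chart_symm
      exact h1.comp (contDiff_snd.contMDiff.comp_contMDiffOn hθ.smooth)
        fun q' hq' => (unitsChart_symm (hθ.snd_ne_zero q' hq')).1
    · have h1 : ContMDiffOn (J.prod 𝓘(ℝ, ℝ)) J ∞ (fun p : A × ℝˣ => orbitChart J hmk hθ p.1)
          ((mk '' θ.source) ×ˢ univ) :=
        (contMDiffOn_of_mem_maximalAtlas hψ).comp contMDiffOn_fst fun p hp => hp.1
      have h2 : ContMDiffOn (J.prod 𝓘(ℝ, ℝ)) 𝓘(ℝ, G × ℝ) ∞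
          (fun p : A × ℝˣ => (J (orbitChart J hmk hθ p.1), (p.2 : ℝ)))
          ((mk '' θ.source) ×ˢ univ) :=
        (J.contMDiff.comp_contMDiffOn h1).prodMk_space
          (Units.contMDiff_val.comp_contMDiffOn contMDiffOn_snd)
      exact hθ.smooth_symm.comp h2
        fun p hp => (hθ.mem_target_of_orbit J hmk hp.1 p.2.ne_zero).1
    · intro q' hq' s
      refine Prod.ext (hmk.smul s q') (Units.ext ?_)
      have h0 := hθ.snd_ne_zero q' hq'
      change ((chartAt ℝ (1 : ℝˣ)).symm (θ (s • q')).2 : ℝ) =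
        s * ((chartAt ℝ (1 : ℝˣ)).symm (θ q').2 : ℝ)
      rw [hθ.apply_smul s q' hq', (unitsChart_symm h0).2,
        (unitsChart_symm (mul_ne_zero s.ne_zero h0)).2]

/-- The charts induced by principal charts are smooth for every smooth structure for which the orbit
map is a principal bundle. -/
theorem IsPrincipalBundle.orbitChart_mem_maximalAtlas (h : IsPrincipalBundle I J mk) :
    orbitChart J hmk hθ ∈ IsManifold.maximalAtlas J ∞ A := by
  have hJ : ContMDiff 𝓘(ℝ, G) J ∞ J.symm := by
    have : ContMDiffOn 𝓘(ℝ, G) J ∞ J.symm (range J) := J.contMDiffOn_symm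
    rwa [J.range_eq_univ, contMDiffOn_univ] at this
  refine OpenPartialHomeomorph.mem_maximalAtlas_of_contMDiffOn _ ?_ ?_
  · rintro _ ⟨q, hq, rfl⟩
    refine ContMDiffAt.contMDiffWithinAt ?_
    -- A smooth local section for the given structure replaces the arbitrary representative of an
    -- orbit, so the orbit chart is locally a composite of smooth maps.
    obtain ⟨σ, hσq, hσ, hπσ⟩ := h.exists_local_section q
    have hq' : σ (mk q) ∈ θ.source := by rwa [hσq]
    have h1 : ContMDiffAt J J ∞ (fun a => J.symm (θ (σ a)).1) (mk q) :=
      hJ.contMDiffAt.comp (mk q) (contDiff_fst.contMDiff.contMDiffAt.comp (mk q)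
        ((hθ.contMDiffAt hq').comp (mk q) hσ))
    refine h1.congr_of_eventuallyEq ?_
    filter_upwards [hπσ, hσ.continuousAt.preimage_mem_nhds (θ.open_source.mem_nhds hq')]
      with a ha ha'
    rw [← orbitChart_mk J hmk hθ ha', ha]
  · have h1 : ContMDiff J 𝓘(ℝ, G × ℝ) ∞ (fun l => (J l, (1 : ℝ))) :=
      J.contMDiff.prodMk_space contMDiff_const
    exact h.smooth_proj.comp_contMDiffOn (hθ.smooth_symm.comp h1.contMDiffOn fun l hl => hl)

end Smooth

/-- The atlas of the orbit space given by the principal charts. -/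
@[reducible]
def orbitChartedSpace (hmk : IsOrbitMap mk)
    (hcov : ∀ q : Q, ∃ θ : OpenPartialHomeomorph Q (G × ℝ), IsPrincipalChart I θ ∧ q ∈ θ.source) :
    ChartedSpace L A where
  atlas := {ψ | ∃ (θ : OpenPartialHomeomorph Q (G × ℝ)) (hθ : IsPrincipalChart I θ),
    ψ = orbitChart J hmk hθ}
  chartAt a := orbitChart J hmk
    (hcov (surjInv hmk.isOpenQuotientMap.surjective a)).choose_spec.1
  mem_chart_source a := by
    refine ⟨_, (hcov (surjInv hmk.isOpenQuotientMap.surjective a)).choose_spec.2, ?_⟩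
    exact surjInv_eq hmk.isOpenQuotientMap.surjective a
  chart_mem_atlas a := ⟨_, _, rfl⟩

omit [J.Boundaryless] in
-- Two members of the maximal atlas of `c₂` are compatible, so each of them is compatible with all
-- charts of `c₁`.
theorem maximalAtlas_subset_of_atlas_subset (c₁ c₂ : ChartedSpace L A)
    (h₁₂ : @atlas L _ A _ c₁ ⊆ @IsManifold.maximalAtlas ℝ _ G _ _ L _ J ∞ A _ c₂) :
    @IsManifold.maximalAtlas ℝ _ G _ _ L _ J ∞ A _ c₂ ⊆
      @IsManifold.maximalAtlas ℝ _ G _ _ L _ J ∞ A _ c₁ := by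
  intro e he e' he'
  have h3 := h₁₂ he'
  exact ⟨@StructureGroupoid.compatible_of_mem_maximalAtlas L A _ _ c₂ (contDiffGroupoid ∞ J) e e'
      he h3,
    @StructureGroupoid.compatible_of_mem_maximalAtlas L A _ _ c₂ (contDiffGroupoid ∞ J) e' e
      h3 he⟩

omit [J.Boundaryless] in
theorem sameSmoothStructure_of_subset (c c' : ChartedSpace L A)
    (hc' : @IsManifold ℝ _ G _ _ L _ J ∞ A _ c')
    (h : @atlas L _ A _ c ⊆ @IsManifold.maximalAtlas ℝ _ G _ _ L _ J ∞ A _ c') :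
    SameSmoothStructure J c c' := by
  have h1 := maximalAtlas_subset_of_atlas_subset J c c' h
  refine Subset.antisymm (maximalAtlas_subset_of_atlas_subset J c' c ?_) h1
  -- The inclusion `h1` puts the atlas of `c'` inside the maximal atlas of `c`, so the lemma applies
  -- with the roles exchanged.
  exact Subset.trans (@IsManifold.subset_maximalAtlas ℝ _ G _ _ L _ J ∞ A _ c' hc') h1

/-- The orbit space of an action covered by principal charts has a unique smooth structure for which
the orbit map is a principal bundle. -/
theorem IsOrbitMap.exists_smoothStructure (hmk : IsOrbitMap mk)
    (hcov : ∀ q : Q, ∃ θ : OpenPartialHomeomorph Q (G × ℝ), IsPrincipalChart I θ ∧ q ∈ θ.source) :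
    ∃ c : ChartedSpace L A, IsManifold J ∞ A ∧ IsPrincipalBundle I J mk ∧
      ∀ c' : ChartedSpace L A, IsManifold J ∞ A → IsPrincipalBundle I J mk →
        SameSmoothStructure J c c' := by
  let c : ChartedSpace L A := orbitChartedSpace J hmk hcov
  have hM : IsManifold J ∞ A := by
    refine isManifold_of_contDiffOn J ∞ A ?_
    rintro _ _ ⟨θ, hθ, rfl⟩ ⟨θ', hθ', rfl⟩
    exact contDiffOn_orbitChart_transition J hmk hθ hθ'
  refine ⟨c, hM, hmk.isPrincipalBundle J fun q => ?_, fun c' hc' h' => ?_⟩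
  · obtain ⟨θ, hθ, hq⟩ := hcov q
    exact ⟨θ, hθ, hq, IsManifold.subset_maximalAtlas ⟨θ, hθ, rfl⟩⟩
  · refine sameSmoothStructure_of_subset J c c' hc' ?_
    rintro _ ⟨θ, hθ, rfl⟩
    exact @IsPrincipalBundle.orbitChart_mem_maximalAtlas E _ _ H _ I Q _ _ _ G _ _ L _ J A _ mk
      hmk θ hθ _ c' hc' h'

end Quotient

/-! ### Principal charts on the tangent bundle. -/

section TangentPrincipalChart

/-- The map `((x, t), (a, b)) ↦ ((x, (a, b / t)), t)`, whose first component consists of functions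
invariant under the scalings of `t` and `b`. -/
def invariantCoord (G : Type*) [NormedAddCommGroup G] [NormedSpace ℝ G] :
    OpenPartialHomeomorph ((G × ℝ) × (G × ℝ)) ((G × (G × ℝ)) × ℝ) where
  toFun p := ((p.1.1, (p.2.1, p.1.2⁻¹ * p.2.2)), p.1.2)
  invFun q := ((q.1.1, q.2), (q.1.2.1, q.2 * q.1.2.2))
  source := {p | p.1.2 ≠ 0}
  target := {q | q.2 ≠ 0}
  map_source' _ hp := hp
  map_target' _ hq := hq
  left_inv' := by
    rintro ⟨⟨x, t⟩, a, b⟩ ht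
    simp [mul_inv_cancel_left₀ (show t ≠ 0 from ht)]
  right_inv' := by
    rintro ⟨⟨x, a, c⟩, t⟩ ht
    simp [inv_mul_cancel_left₀ (show t ≠ 0 from ht)]
  open_source := isOpen_ne_fun (by fun_prop) continuous_const
  open_target := isOpen_ne_fun (by fun_prop) continuous_const
  continuousOn_toFun := by
    have h : ContinuousOn (fun p : (G × ℝ) × (G × ℝ) => p.1.2⁻¹) {p | p.1.2 ≠ 0} :=
      ContinuousOn.inv₀ (by fun_prop) fun _ hp => hp
    fun_prop
  continuousOn_invFun := by fun_prop

variable {E : Type*} [NormedAddCommGroup E] [NormedSpace ℝ E]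
  {H : Type*} [TopologicalSpace H] {I : ModelWithCorners ℝ E H}
  {P : Type*} [TopologicalSpace P] [ChartedSpace H P] [IsManifold I ∞ P]
  {G : Type*} [NormedAddCommGroup G] [NormedSpace ℝ G]

theorem contDiffOn_invariantCoord :
    ContDiffOn ℝ ∞ (invariantCoord G) (invariantCoord G).source := by
  have h : ContDiffOn ℝ ∞ (fun p : (G × ℝ) × (G × ℝ) => p.1.2⁻¹) {p | p.1.2 ≠ 0} :=
    ContDiffOn.inv (by fun_prop) fun _ hp => hp
  change ContDiffOn ℝ ∞ (fun p : (G × ℝ) × (G × ℝ) =>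
    ((p.1.1, (p.2.1, p.1.2⁻¹ * p.2.2)), p.1.2)) {p | p.1.2 ≠ 0}
  fun_prop

theorem contDiff_invariantCoord_symm : ContDiff ℝ ∞ (invariantCoord G).symm := by
  change ContDiff ℝ ∞ (fun q : (G × (G × ℝ)) × ℝ => ((q.1.1, q.2), (q.1.2.1, q.2 * q.1.2.2)))
  fun_prop

variable [MulAction ℝˣ P] [ContMDiffSMul 𝓘(ℝ, ℝ) I ∞ ℝˣ P]
  {θ : OpenPartialHomeomorph P (G × ℝ)}

/-- In the chart the action of `s` is the linear map `D`, which is its own derivative; the lift thus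
acts by `D` on base and fibre coordinates alike. -/
theorem IsPrincipalChart.tangentCoord_smul (hθ : IsPrincipalChart I θ) (s : ℝˣ)
    (v : TangentBundle I P) (hv : v.proj ∈ θ.source) :
    tangentCoord θ hθ.toIsSmoothCoord (s • v) =
      (((θ v.proj).1, s * (θ v.proj).2),
        (((tangentCoord θ hθ.toIsSmoothCoord v).2.1,
          s * (tangentCoord θ hθ.toIsSmoothCoord v).2.2) : G × ℝ)) := by
  refine Prod.ext (hθ.apply_smul s _ hv) ?_
  have hs : MDifferentiableAt I I (fun p : P => s • p) v.proj :=
    (contMDiff_smul_left s).mdifferentiableAt (by simp)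
  have h1 := mfderiv_comp v.proj (hθ.mdifferentiableAt (hθ.smul_mem s _ hv)) hs
  let D : G × ℝ →L[ℝ] G × ℝ := (ContinuousLinearMap.fst ℝ G ℝ).prod
    ((s : ℝ) • ContinuousLinearMap.snd ℝ G ℝ)
  have h2 : mfderiv I 𝓘(ℝ, G × ℝ) (D ∘ θ) v.proj =
      (mfderiv 𝓘(ℝ, G × ℝ) 𝓘(ℝ, G × ℝ) D (θ v.proj)).comp (mfderiv I 𝓘(ℝ, G × ℝ) θ v.proj) :=
    mfderiv_comp v.proj D.differentiableAt.mdifferentiableAt (hθ.mdifferentiableAt hv)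
  have h3 : (θ ∘ fun p : P => s • p) =ᶠ[𝓝 v.proj] D ∘ θ := by
    filter_upwards [θ.open_source.mem_nhds hv] with p hp
    exact hθ.apply_smul s p hp
  have h4 : mfderiv 𝓘(ℝ, G × ℝ) 𝓘(ℝ, G × ℝ) D (θ v.proj) = D := by
    rw [mfderiv_eq_fderiv, D.fderiv]
  have h5 := (h1.symm.trans h3.mfderiv_eq).trans h2
  have h6 := DFunLike.congr_fun h5 v.snd
  exact h6.trans (DFunLike.congr_fun h4 _)

/-- The chart of `T P` in which the lifted action is the scaling of the last coordinate, induced by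
a principal chart of `P`. -/
def tangentPrincipalChart (hθ : IsPrincipalChart I θ) :
    OpenPartialHomeomorph (TangentBundle I P) ((G × (G × ℝ)) × ℝ) :=
  (tangentCoord θ hθ.toIsSmoothCoord).trans (invariantCoord G)

variable (hθ : IsPrincipalChart I θ)

omit [ContMDiffSMul 𝓘(ℝ, ℝ) I ∞ ℝˣ P] in
theorem mem_tangentPrincipalChart_source {v : TangentBundle I P} :
    v ∈ (tangentPrincipalChart hθ).source ↔ v.proj ∈ θ.source :=
  ⟨fun h => h.1, fun h => ⟨h, hθ.snd_ne_zero _ h⟩⟩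

/-- The common factor `s` of `t` and `b` cancels in `b / t`. This makes the orbit space results
applicable to `T P`. -/
theorem IsPrincipalChart.tangent :
    IsPrincipalChart (G := G × (G × ℝ)) I.tangent (tangentPrincipalChart hθ) where
  smooth := by
    refine ContMDiffOn.comp (I' := 𝓘(ℝ, (G × ℝ) × (G × ℝ))) (g := invariantCoord G)
      contDiffOn_invariantCoord.contMDiffOn (t := (invariantCoord G).source)
      ((isSmoothCoord_tangentCoord hθ.toIsSmoothCoord).smooth.mono ?_) ?_
    · exact fun _ hv => hv.1
    · exact fun _ hv => hv.2
  smooth_symm := by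
    have h := (isSmoothCoord_tangentCoord hθ.toIsSmoothCoord).smooth_symm.comp
      (contDiff_invariantCoord_symm (G := G)).contMDiff.contMDiffOn
      (s := (tangentPrincipalChart hθ).target) fun _ hq => hq.2
    exact h
  smul_mem s v hv := by
    rw [mem_tangentPrincipalChart_source] at hv ⊢
    exact hθ.smul_mem s _ hv
  apply_smul s v hv := by
    rw [mem_tangentPrincipalChart_source] at hv
    refine (congrArg (invariantCoord G) (hθ.tangentCoord_smul s v hv)).trans ?_
    refine Prod.ext (Prod.ext rfl (Prod.ext rfl ?_)) rfl
    change ((s : ℝ) * _)⁻¹ * ((s : ℝ) * _) = _⁻¹ * _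
    rw [mul_inv_rev, mul_assoc, inv_mul_cancel_left₀ s.ne_zero]
    rfl
  snd_ne_zero v hv := hv.2

end TangentPrincipalChart

/-! ### Topology of the Atiyah algebroid. -/

section Atiyah

variable {E : Type*} [NormedAddCommGroup E] [NormedSpace ℝ E]
  {H : Type*} [TopologicalSpace H] (I : ModelWithCorners ℝ E H)
  (P : Type*) [TopologicalSpace P] [ChartedSpace H P] [IsManifold I ∞ P]
  [MulAction ℝˣ P] [ContMDiffSMul 𝓘(ℝ, ℝ) I ∞ ℝˣ P]

instance continuousConstSMul_tangentBundle : ContinuousConstSMul ℝˣ (TangentBundle I P) where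
  continuous_const_smul s := (contMDiff_tangentMap_smul s).continuous

theorem isOrbitMap_atiyahAlgebroidMk : IsOrbitMap (AtiyahAlgebroid.mk I P) where
  isOpenQuotientMap := MulAction.isOpenQuotientMap_quotientMk
  eq_iff v w := by
    refine Quotient.eq.trans ?_
    rw [MulAction.orbitRel_apply]
    constructor
    · rintro ⟨s, rfl⟩
      exact ⟨s⁻¹, inv_smul_smul s w⟩
    · rintro ⟨s, rfl⟩
      exact ⟨s⁻¹, inv_smul_smul s v⟩

/-- Tangent bundle charts contain whole fibres, so a countable cover of the base by chart domains
lifts; the zero vectors only index the lifted charts. -/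
theorem secondCountable_tangentBundle (I : ModelWithCorners ℝ E H) [I.Boundaryless]
    [FiniteDimensional ℝ E]
    (X : Type*) [TopologicalSpace X] [ChartedSpace H X] [IsManifold I ∞ X]
    [SecondCountableTopology X] : SecondCountableTopology (TangentBundle I X) := by
  have : SecondCountableTopology E := inferInstance
  have hH : SecondCountableTopology H := I.isClosedEmbedding.isEmbedding.secondCountableTopology
  have : SecondCountableTopology (ModelProd H E) :=
    inferInstanceAs (SecondCountableTopology (H × E))
  obtain ⟨s, hs, hcov⟩ := TopologicalSpace.countable_cover_nhds
    fun x : X => (chartAt H x).open_source.mem_nhds (mem_chart_source H x)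
  refine ChartedSpace.secondCountable_of_countable_cover (ModelProd H E)
    (s := (fun x : X => (⟨x, 0⟩ : TangentBundle I X)) '' s) ?_ (hs.image _)
  refine eq_univ_of_forall fun v => ?_
  obtain ⟨x, hx, hv⟩ := mem_iUnion₂.1 (hcov.symm ▸ mem_univ v.proj)
  refine mem_iUnion₂.2 ⟨_, ⟨x, hx, rfl⟩, ?_⟩
  rw [TangentBundle.mem_chart_source_iff]
  exact hv

theorem secondCountable_atiyahAlgebroid [I.Boundaryless] [FiniteDimensional ℝ E]
    [SecondCountableTopology P] : SecondCountableTopology (AtiyahAlgebroid I P) := by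
  have := secondCountable_tangentBundle I P
  exact (isOrbitMap_atiyahAlgebroidMk I P).isOpenQuotientMap.isQuotientMap.secondCountableTopology
    (isOrbitMap_atiyahAlgebroidMk I P).isOpenQuotientMap.isOpenMap

end Atiyah

/-- An orbit space is Hausdorff if it maps continuously to a Hausdorff space in such a way that
orbits in the same fibre lie in a common chart. -/
theorem IsOrbitMap.t2Space
  {E : Type*} [NormedAddCommGroup E] [NormedSpace ℝ E]
  {H : Type*} [TopologicalSpace H] {I : ModelWithCorners ℝ E H}
  {Q : Type*} [TopologicalSpace Q] [ChartedSpace H Q] [MulAction ℝˣ Q]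
  {G : Type*} [NormedAddCommGroup G] [NormedSpace ℝ G]
  {A : Type*} [TopologicalSpace A] {M : Type*} [TopologicalSpace M] [T2Space M]
  {mk : Q → A} (hmk : IsOrbitMap mk) (f : Q → M) (hf : Continuous f)
    (hinv : ∀ (s : ℝˣ) (q : Q), f (s • q) = f q)
    (hcov : ∀ x : M, ∃ θ : OpenPartialHomeomorph Q (G × ℝ), IsPrincipalChart I θ ∧
      f ⁻¹' {x} ⊆ θ.source) : T2Space A := by
  refine ⟨fun a b hab => ?_⟩
  obtain ⟨q, rfl⟩ := hmk.isOpenQuotientMap.surjective a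
  obtain ⟨q', rfl⟩ := hmk.isOpenQuotientMap.surjective b
  let g : A → M := fun a => f (surjInv hmk.isOpenQuotientMap.surjective a)
  have hg : ∀ q, g (mk q) = f q := by
    intro q
    obtain ⟨s, hs⟩ := (hmk.eq_iff _ _).1
      (surjInv_eq hmk.isOpenQuotientMap.surjective (mk q)).symm
    change f (surjInv hmk.isOpenQuotientMap.surjective (mk q)) = f q
    rw [← hs, hinv]
  have hgc : Continuous g := by
    rw [hmk.isOpenQuotientMap.isQuotientMap.continuous_iff]
    exact hf.congr fun q => (hg q).symm
  -- Orbits over the same point are separated inside one chart, since its model space is Hausdorff;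
  -- orbits over different points are separated by the induced map `g`.
  by_cases h : f q = f q'
  · obtain ⟨θ, hθ, hsub⟩ := hcov (f q)
    have hq : q ∈ θ.source := hsub rfl
    have hq' : q' ∈ θ.source := hsub h.symm
    let ψ := orbitChart 𝓘(ℝ, G) hmk hθ
    have hψ : mk q ∈ ψ.source := ⟨q, hq, rfl⟩
    have hψ' : mk q' ∈ ψ.source := ⟨q', hq', rfl⟩
    obtain ⟨u, v, hu, hv, hau, hbv, huv⟩ := t2_separation (ψ.injOn.ne hψ hψ' hab)
    exact ⟨ψ.source ∩ ψ ⁻¹' u, ψ.source ∩ ψ ⁻¹' v, ψ.isOpen_inter_preimage hu,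
      ψ.isOpen_inter_preimage hv, ⟨hψ, hau⟩, ⟨hψ', hbv⟩,
      (huv.preimage ψ).mono inter_subset_right inter_subset_right⟩
  · rw [← hg q, ← hg q'] at h
    exact separated_by_continuous hgc h

end ContactLift

end

/-! ### The theorem. -/

open ContactLift in
theorem mainTheorem5
    {E : Type*} [NormedAddCommGroup E] [NormedSpace ℝ E] [FiniteDimensional ℝ E]
    {H : Type*} [TopologicalSpace H] (I : ModelWithCorners ℝ E H) [I.Boundaryless]
    {F : Type*} [NormedAddCommGroup F] [NormedSpace ℝ F] [FiniteDimensional ℝ F]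
    {K : Type*} [TopologicalSpace K] (J : ModelWithCorners ℝ F K) [J.Boundaryless]
    {P : Type*} [TopologicalSpace P] [ChartedSpace H P] [IsManifold I ∞ P]
    [T2Space P] [SecondCountableTopology P]
    {M : Type*} [TopologicalSpace M] [ChartedSpace K M] [IsManifold J ∞ M]
    [T2Space M] [SecondCountableTopology M]
    [MulAction ℝˣ P] [ContMDiffSMul 𝓘(ℝ, ℝ) I ∞ ℝˣ P]
    (π : P → M) (Ω : DForm I P 2) (hP : IsSymplecticPrincipalBundle I J π Ω) :
    ∃ c : ChartedSpace (ModelProd K (F × ℝ)) (AtiyahAlgebroid I P),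
      IsManifold (J.prod 𝓘(ℝ, F × ℝ)) ∞ (AtiyahAlgebroid I P) ∧
      T2Space (AtiyahAlgebroid I P) ∧ SecondCountableTopology (AtiyahAlgebroid I P) ∧
      IsSymplecticPrincipalBundle I.tangent (J.prod 𝓘(ℝ, F × ℝ))
        (AtiyahAlgebroid.mk I P) (Ω.tangentLift I) ∧
      (∃! C : ∀ y : AtiyahAlgebroid I P, Submodule ℝ (TangentSpace (J.prod 𝓘(ℝ, F × ℝ)) y),
        IsContactStructure (J.prod 𝓘(ℝ, F × ℝ)) C ∧
        CorrespondsTo I.tangent (J.prod 𝓘(ℝ, F × ℝ)) C (AtiyahAlgebroid.mk I P)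
          (Ω.tangentLift I)) ∧
      ∀ c' : ChartedSpace (ModelProd K (F × ℝ)) (AtiyahAlgebroid I P),
        IsManifold (J.prod 𝓘(ℝ, F × ℝ)) ∞ (AtiyahAlgebroid I P) →
        IsPrincipalBundle I.tangent (J.prod 𝓘(ℝ, F × ℝ)) (AtiyahAlgebroid.mk I P) →
        SameSmoothStructure (J.prod 𝓘(ℝ, F × ℝ)) c c' := by
  have hcont : Continuous π := hP.principal.smooth_proj.continuous
  have hproj : Continuous (Bundle.TotalSpace.proj : TangentBundle I P → P) :=
    (Bundle.contMDiff_proj (n := ∞) (IB := I) (TangentSpace I)).continuous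
  have hmk := isOrbitMap_atiyahAlgebroidMk I P
  -- One chart contains all tangent vectors over the fibre of `x`. This is more than the cover
  -- needed for the smooth structure and is exactly what `IsOrbitMap.t2Space` requires.
  have hchart : ∀ x : M, ∃ θ : OpenPartialHomeomorph (TangentBundle I P) ((F × (F × ℝ)) × ℝ),
      IsPrincipalChart (G := F × (F × ℝ)) I.tangent θ ∧ ∀ v, π v.proj = x → v ∈ θ.source := by
    intro x
    obtain ⟨θ, U, hθ, -, hxU, -, hsrc, -⟩ := hP.principal.exists_principalChart x
    refine ⟨tangentPrincipalChart hθ, hθ.tangent, fun v hv => ?_⟩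
    rw [mem_tangentPrincipalChart_source, hsrc, mem_preimage, hv]
    exact hxU
  obtain ⟨c, hM, hbundle, huniq⟩ := hmk.exists_smoothStructure (J.prod 𝓘(ℝ, F × ℝ)) fun v =>
    let ⟨θ, hθ, h⟩ := hchart (π v.proj)
    ⟨θ, hθ, h v rfl⟩
  have hT : IsSymplecticPrincipalBundle I.tangent (J.prod 𝓘(ℝ, F × ℝ)) (AtiyahAlgebroid.mk I P)
      (Ω.tangentLift I) := ⟨hbundle, hP.symplectic.tangentLift, hP.homogeneous.tangentLift hP.symplectic⟩
  refine ⟨c, hM, ?_, secondCountable_atiyahAlgebroid I P, hT,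
    -- The model `F × (F × ℝ)` has dimension `2 n + 1` with `n` the dimension of `F`, whatever the
    -- parity of `n`.
    hT.existsUnique_contactStructure ⟨Module.finrank ℝ F, ?_⟩, huniq⟩
  · exact hmk.t2Space (fun v => π v.proj) (hcont.comp hproj)
      (fun s v => hP.principal.proj_smul s v.proj) hchart
  · simp only [Module.finrank_prod, Module.finrank_self]
    ring
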